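/- For real $X\ge 3$ let $P$ be a uniformly random prime from the set of primes in $[X,2X]$. For $m\ge1$ and integers $0=h_0<h_1<\dots<h_m$ (an offset pattern $\mathbf h$) let $\mathcal C_{\mathbf h}(n)$ be the event that $n+h_j$ is prime for every $0\le j\le m$, let $\nu_p(\mathbf h)$ be the number of distinct residue classes modulo $p$ among $h_0,\dots,h_m$, and let $$\mathfrak S(\mathbf h)=\prod_{p\ \mathrm{prime}}\Bigl(1-\frac{\nu_p(\mathbf h)}{p}\Bigr)\Bigl(1-\frac1p\Bigr)^{-(m+1)}$$ be the singular series of $\mathbf h$ (the product converges unconditionally, to $0$ if some factor vanishes). Theorem. Fix $m\ge1$. There are constants $C_m,C_m'>0$, $A_m\in\mathbb N$ and $X_0(m)\ge 3$, depending only on $m$, such that the following hold. (i) For all real $X\ge X_0(m)$ and all offset patterns $0=h_0<h_1<\dots<h_m\le 2X$, $$\Pr[\mathcal C_{\mathbf h}(P)]\le C_m\frac{\mathfrak S(\mathbf h)}{(\log X)^m}\qquad\text{and}\qquad \frac{\mathfrak S(\mathbf h)}{(\log X)^m}\le C_m'\,\frac{(\log\log 3X)^{A_m}}{(\log X)^m}.$$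 (ii) For all real $X\ge X_0(m)$ and every finite set $\mathcal H$ of offset patterns $0=h_0<\dots<h_m\le 2X$, $$\Pr[\exists\,\mathbf h\in\mathcal H:\ \mathcal C_{\mathbf h}(P)]\le C_m'\,\frac{|\mathcal H|\,(\log\log 3X)^{A_m}}{(\log X)^m}.$$ In particular, for an arbitrary fixed finite set $\mathcal H$ of offset patterns $0=h_0<\dots<h_m$ the same bound, with the same constants $C_m'$ and $A_m$, holds for all $X\ge X_1(m,\mathcal H)$. -/

import Mathlib

open MeasureTheory ProbabilityTheory

/-- The primes in the dyadic interval `[X, 2X]`. -/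
def dyadicPrimes (X : ℝ) : Set ℕ :=
  {p : ℕ | p.Prime ∧ X ≤ (p : ℝ) ∧ (p : ℝ) ≤ 2 * X}

/-- The law of a prime `P` drawn uniformly from `[X, 2X]`. -/
noncomputable def primeLaw (X : ℝ) : Measure ℕ :=
  uniformOn (dyadicPrimes X)

/-- Offset patterns `0 = h_0 < h_1 < ⋯ < h_m`. -/
def IsOffsetPattern {m : ℕ} (h : Fin (m + 1) → ℕ) : Prop :=
  h 0 = 0 ∧ StrictMono h

/-- The constellation event: `n + h_j` is prime for every `0 ≤ j ≤ m`. -/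
def Constellation {m : ℕ} (h : Fin (m + 1) → ℕ) (n : ℕ) : Prop :=
  ∀ j, (n + h j).Prime

/-- The number of distinct residue classes modulo `p` occupied by `h_0, …, h_m`. -/
def residueCount {m : ℕ} (h : Fin (m + 1) → ℕ) (p : ℕ) : ℕ :=
  (Finset.univ.image fun j => ((h j : ℕ) : ZMod p)).card

/-- The Euler factor at `p` of the singular series of the `(m + 1)`-tuple `h`. -/
noncomputable def singularFactor {m : ℕ} (h : Fin (m + 1) → ℕ) (p : Nat.Primes) : ℝ :=
  (1 - (residueCount h (p : ℕ) : ℝ) / ((p : ℕ) : ℝ)) /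
    (1 - 1 / ((p : ℕ) : ℝ)) ^ (m + 1)

/-- The singular series of the `(m + 1)`-tuple `h`, as an Euler product over all primes. -/
noncomputable def singularSeries {m : ℕ} (h : Fin (m + 1) → ℕ) : ℝ :=
  ∏' p : Nat.Primes, singularFactor h p

/-! The probability bound is Selberg's upper bound sieve. If `n` and all `n + h j` are primes
exceeding `z`, then `n` avoids the `residueCount h p` classes `-h j` modulo every prime `p ≤ z`.
`selberg_sieve` bounds the number of such `n` in an interval of length `N` by `N / S` plus a power
of `z`. Rankin's trick (`half_prod_le_selberg_sum`) shows that `S` is at least half of `∏ (1 - ν_p /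
p)⁻¹` over `p ≤ z`. Comparison with the truncated Euler product and with `∏ (1 - 1/p)⁻¹ ≥ log z`
gives a main term of order `𝔖(h) N / (log z)^(m+1)`. With `z` a small fixed power of `X`, division
by the number of primes in `[X, 2X]`, at least `X / (20 log X)`, removes one logarithm.

The sieve error is absorbed because `𝔖(h)` is bounded below in terms of `m` when no prime has all
its classes occupied (`IsOffsetPattern.le_singularSeries`). If some prime does, it is at most `m +
1` and the event is empty once `X > m + 1`.

For the size of `𝔖(h)`, a factor exceeds 1 only at primes dividing some difference of offsets, and
there it is at most `(1 - 1/p)⁻¹ ^ m`. There are `O(log X)` such primes; those up to about `log X`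
contribute a power of `log log X` by a crude Mertens bound, the others a bounded factor. Families
follow from the union bound. -/

/-! ### Selberg's quadratic form on a Boolean lattice -/

/-- This is the orthogonality behind Möbius inversion: writing `T = L ∪ x` with `x ⊆ M \ L` leaves
an alternating sum over all subsets of `M \ L`. -/
theorem sum_Icc_neg_one_pow_card {ι : Type*} [DecidableEq ι] {L M : Finset ι} (h : L ⊆ M) :
    ∑ T ∈ Finset.Icc L M, (-1 : ℝ) ^ T.card = if L = M then (-1) ^ L.card else 0 := by
  rw [Finset.Icc_eq_image_powerset h, Finset.sum_image]
  · have : ∀ x ∈ (M \ L).powerset, (-1 : ℝ) ^ (L ∪ x).card = (-1) ^ L.card * (-1) ^ x.card := by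
      intro x hx
      rw [Finset.mem_powerset] at hx
      rw [Finset.card_union_of_disjoint, pow_add]
      exact Finset.disjoint_of_subset_right hx Finset.disjoint_sdiff
    rw [Finset.sum_congr rfl this, ← Finset.mul_sum]
    have h2 := Finset.sum_powerset_neg_one_pow_card (x := M \ L)
    have h3 : ∑ x ∈ (M \ L).powerset, (-1 : ℝ) ^ x.card = if M \ L = ∅ then 1 else 0 := by
      exact_mod_cast congrArg (Int.cast : ℤ → ℝ) h2
    rw [h3]
    by_cases hLM : L = M
    · simp [hLM]
    · have : ¬ M \ L = ∅ := by
        rw [Finset.sdiff_eq_empty_iff_subset]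
        exact fun h' => hLM (h.antisymm h')
      simp [hLM, this]
  · intro x hx y hy hxy
    simp only [Finset.coe_powerset, Set.mem_preimage, Set.mem_powerset_iff, Finset.coe_subset]
      at hx hy
    have hx' := Finset.disjoint_of_subset_right hx Finset.disjoint_sdiff
    have hy' := Finset.disjoint_of_subset_right hy Finset.disjoint_sdiff
    have := congrArg (· \ L) hxy
    simp only [Finset.union_sdiff_left] at this
    rwa [Finset.sdiff_eq_self_of_disjoint hx'.symm,
      Finset.sdiff_eq_self_of_disjoint hy'.symm] at this

/-- This diagonalises the quadratic form: the product over `T ∪ U` is the product over `T` times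
that over `U`, divided by that over `T ∩ U`, and `∏ (h i)⁻¹ = ∏ (1 + (1 - h i) / h i)` expands over
subsets of `T ∩ U`. -/
theorem prod_union_eq_mul_sum_powerset {ι : Type*} [DecidableEq ι] (P : Finset ι) (h : ι → ℝ)
    (h0 : ∀ i ∈ P, 0 < h i) {T : Finset ι} (hT : T ⊆ P) (U : Finset ι) :
    ∏ i ∈ T ∪ U, h i = (∏ i ∈ T, h i) * (∏ i ∈ U, h i) *
      ∑ L ∈ P.powerset, if L ⊆ T ∧ L ⊆ U then ∏ i ∈ L, (h i / (1 - h i))⁻¹ else 0 := by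
  have h1 : ∑ L ∈ P.powerset, (if L ⊆ T ∧ L ⊆ U then ∏ i ∈ L, (h i / (1 - h i))⁻¹ else 0)
      = ∏ i ∈ T ∩ U, (h i)⁻¹ := by
    rw [← Finset.sum_filter]
    have : P.powerset.filter (fun L => L ⊆ T ∧ L ⊆ U) = (T ∩ U).powerset := by
      ext L
      simp only [Finset.mem_filter, Finset.mem_powerset, Finset.subset_inter_iff]
      exact ⟨fun h => h.2, fun h => ⟨h.1.trans hT, h⟩⟩
    rw [this, ← Finset.prod_add_one]
    refine Finset.prod_congr rfl fun i hi => ?_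
    have := h0 i (hT (Finset.mem_inter.1 hi).1)
    field_simp
    ring
  rw [h1, ← Finset.prod_union_inter, mul_assoc, ← Finset.prod_mul_distrib,
    Finset.prod_eq_one (s := T ∩ U), mul_one]
  intro i hi
  exact mul_inv_cancel₀ (h0 i (hT (Finset.mem_inter.1 hi).1)).ne'

/-- Selberg's optimal weights, on the Boolean lattice of subsets of a finite set `P`, supported on
a lower set `D`. -/
theorem exists_selberg_weights {ι : Type*} [DecidableEq ι] (P : Finset ι) (h : ι → ℝ)
    (h0 : ∀ i ∈ P, 0 < h i) (h1 : ∀ i ∈ P, h i < 1) (D : Finset (Finset ι))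
    (hDP : ∀ L ∈ D, L ⊆ P) (hD : ∀ L ∈ D, ∀ T ⊆ L, T ∈ D) (hne : ∅ ∈ D) :
    ∃ w : Finset ι → ℝ, w ∅ = 1 ∧ (∀ T ∉ D, w T = 0) ∧ (∀ T ∈ D, |w T| ≤ ∏ i ∈ T, (h i)⁻¹) ∧
      ∑ T ∈ P.powerset, ∑ U ∈ P.powerset, w T * w U * ∏ i ∈ T ∪ U, h i =
        (∑ L ∈ D, ∏ i ∈ L, h i / (1 - h i))⁻¹ := by
  set g : Finset ι → ℝ := fun L => ∏ i ∈ L, h i / (1 - h i) with hg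
  set S : ℝ := ∑ L ∈ D, g L with hS
  have gpos : ∀ L ⊆ P, 0 < g L := fun L hL => Finset.prod_pos fun i hi =>
    div_pos (h0 i (hL hi)) (sub_pos.2 (h1 i (hL hi)))
  have Spos : 0 < S := Finset.sum_pos (fun L hL => gpos L (hDP L hL)) ⟨∅, hne⟩
  have hpos : ∀ L ⊆ P, 0 < ∏ i ∈ L, h i := fun L hL => Finset.prod_pos fun i hi => h0 i (hL hi)
  -- `a T` is `w T * ∏ i ∈ T, h i`. It is the Möbius inverse of the minimiser of the diagonal form,
  -- whose coordinates `∑ T ⊇ L, a T` equal `± g L / S` on `D`.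
  set a : Finset ι → ℝ := fun T => (-1) ^ T.card * (∑ L ∈ D with T ⊆ L, g L) / S with ha
  have key : ∀ L ∈ P.powerset, ∑ T ∈ P.powerset with L ⊆ T, a T =
      if L ∈ D then (-1) ^ L.card * g L / S else 0 := by
    intro L hL
    simp only [ha]
    rw [← Finset.sum_div]
    simp_rw [Finset.mul_sum]
    have : ∑ T ∈ P.powerset with L ⊆ T, ∑ M ∈ D with T ⊆ M, (-1 : ℝ) ^ T.card * g M =
        ∑ M ∈ D with L ⊆ M, ∑ T ∈ Finset.Icc L M, (-1 : ℝ) ^ T.card * g M := by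
      apply Finset.sum_comm'
      intro T M
      simp only [Finset.mem_filter, Finset.mem_powerset, Finset.mem_Icc]
      constructor
      · rintro ⟨⟨h1, h2⟩, h3, h4⟩
        exact ⟨⟨h2, h4⟩, h3, h2.trans h4⟩
      · rintro ⟨⟨h1, h2⟩, h3, h4⟩
        exact ⟨⟨h2.trans (hDP M h3), h1⟩, h3, h2⟩
    rw [this]
    have : ∀ M ∈ D.filter (L ⊆ ·), ∑ T ∈ Finset.Icc L M, (-1 : ℝ) ^ T.card * g M =
        if L = M then (-1) ^ L.card * g M else 0 := by
      intro M hM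
      rw [← Finset.sum_mul, sum_Icc_neg_one_pow_card (Finset.mem_filter.1 hM).2]
      split_ifs <;> simp
    rw [Finset.sum_congr rfl this, Finset.sum_ite_eq]
    by_cases hLD : L ∈ D <;> simp [hLD]
  refine ⟨fun T => a T / ∏ i ∈ T, h i, ?_, ?_, ?_, ?_⟩
  · have : D.filter (fun L => ∅ ⊆ L) = D := Finset.filter_true_of_mem (by simp)
    simp only [ha, this]
    simp [← hS, Spos.ne']
  · intro T hT
    have : D.filter (fun L => T ⊆ L) = ∅ :=
      Finset.filter_false_of_mem fun L hL hTL => hT (hD L hL T hTL)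
    simp [ha, this]
  · intro T hT
    have hTp := hpos T (hDP T hT)
    rw [abs_div, abs_of_pos hTp, Finset.prod_inv_distrib, ← one_div]
    gcongr
    simp only [ha]
    have h2 : 0 ≤ ∑ L ∈ D with T ⊆ L, g L := Finset.sum_nonneg fun L hL =>
      (gpos L (hDP L (Finset.mem_filter.1 hL).1)).le
    rw [abs_div, abs_mul, abs_pow, abs_neg, abs_one, one_pow, one_mul, abs_of_nonneg h2,
      abs_of_pos Spos, div_le_one Spos]
    exact Finset.sum_le_sum_of_subset_of_nonneg (Finset.filter_subset _ _)
      fun L hL _ => (gpos L (hDP L hL)).le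
  -- In the diagonal coordinates the form is `∑ L, (g L)⁻¹ * (∑ T ⊇ L, a T) ^ 2`, which `key`
  -- evaluates to `∑ L ∈ D, g L / S ^ 2 = S⁻¹`.
  · have e1 : ∀ T ∈ P.powerset, ∀ U ∈ P.powerset,
        a T / (∏ i ∈ T, h i) * (a U / ∏ i ∈ U, h i) * ∏ i ∈ T ∪ U, h i =
        ∑ L ∈ P.powerset, (g L)⁻¹ * ((if L ⊆ T then a T else 0) * (if L ⊆ U then a U else 0)) := by
      intro T hT U hU
      rw [Finset.mem_powerset] at hT hU
      rw [prod_union_eq_mul_sum_powerset P h h0 hT U]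
      have := (hpos T hT).ne'
      have := (hpos U hU).ne'
      rw [← mul_assoc]
      have : a T / (∏ i ∈ T, h i) * (a U / ∏ i ∈ U, h i) *
          ((∏ i ∈ T, h i) * ∏ i ∈ U, h i) = a T * a U := by field_simp
      rw [this, Finset.mul_sum]
      refine Finset.sum_congr rfl fun L _ => ?_
      by_cases hT : L ⊆ T <;> by_cases hU : L ⊆ U <;> simp [hT, hU, hg]
      ring
    rw [Finset.sum_congr rfl fun T hT => Finset.sum_congr rfl fun U hU => e1 T hT U hU]
    have e2 : ∑ T ∈ P.powerset, ∑ U ∈ P.powerset, ∑ L ∈ P.powerset,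
        (g L)⁻¹ * ((if L ⊆ T then a T else 0) * (if L ⊆ U then a U else 0)) =
        ∑ L ∈ P.powerset, (g L)⁻¹ * (∑ T ∈ P.powerset with L ⊆ T, a T) ^ 2 := by
      rw [Finset.sum_congr rfl fun T _ => Finset.sum_comm, Finset.sum_comm]
      refine Finset.sum_congr rfl fun L _ => ?_
      rw [sq, Finset.sum_filter, Finset.sum_mul_sum, Finset.mul_sum]
      simp_rw [Finset.mul_sum]
    rw [e2]
    have e3 : ∀ L ∈ P.powerset, (g L)⁻¹ * (∑ T ∈ P.powerset with L ⊆ T, a T) ^ 2 =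
        if L ∈ D then g L / S ^ 2 else 0 := by
      intro L hL
      rw [key L hL]
      have := (gpos L (Finset.mem_powerset.1 hL)).ne'
      split_ifs
      · rw [div_pow, mul_pow, ← pow_mul, mul_comm L.card, pow_mul, neg_one_sq, one_pow, one_mul]
        field_simp
      · simp
    rw [Finset.sum_congr rfl e3, ← Finset.sum_filter]
    have : P.powerset.filter (· ∈ D) = D := by
      ext L
      simp only [Finset.mem_filter, Finset.mem_powerset]
      exact ⟨fun h => h.2, fun h => ⟨hDP L h, h⟩⟩
    rw [this, ← Finset.sum_div, ← hS]
    field_simp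

/-! ### Equidistribution in residue classes and the Selberg sieve -/

theorem card_filter_Ico_mul_of_periodic (p : ℕ → Prop) [DecidablePred p] {M : ℕ}
    (hp : Function.Periodic p M) (a q : ℕ) :
    ((Finset.Ico a (a + q * M)).filter p).card = q * M.count p := by
  induction q with
  | zero => simp
  | succ q ih =>
    have h1 : Finset.Ico a (a + (q + 1) * M) =
        Finset.Ico a (a + q * M) ∪ Finset.Ico (a + q * M) (a + q * M + M) := by
      rw [Finset.Ico_union_Ico_eq_Ico (by omega) (by omega)]
      congr 1
      ring
    rw [h1, Finset.filter_union, Finset.card_union_of_disjoint, ih,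
      Nat.filter_Ico_card_eq_of_periodic _ _ p hp]
    · ring
    · exact Finset.disjoint_filter_filter (Finset.Ico_disjoint_Ico_consecutive _ _ _)

/-- Both the count and its expected value lie between those of `N / M` and `N / M + 1` full periods.
-/
theorem abs_card_filter_Ico_sub_le (p : ℕ → Prop) [DecidablePred p] {M : ℕ} (hM : 0 < M)
    (hp : Function.Periodic p M) (a N : ℕ) :
    |(((Finset.Ico a (a + N)).filter p).card : ℝ) - N * (M.count p / M)| ≤ M := by
  have hdm := Nat.div_add_mod N M
  have hlt := Nat.mod_lt N hM
  set q := N / M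
  have hNM : q * M = M * q := mul_comm _ _
  have h1 : q * M.count p ≤ ((Finset.Ico a (a + N)).filter p).card := by
    rw [← card_filter_Ico_mul_of_periodic p hp a q]
    exact Finset.card_le_card (Finset.filter_subset_filter _
      (Finset.Ico_subset_Ico_right (by omega)))
  have h2 : ((Finset.Ico a (a + N)).filter p).card ≤ (q + 1) * M.count p := by
    rw [← card_filter_Ico_mul_of_periodic p hp a (q + 1)]
    refine Finset.card_le_card (Finset.filter_subset_filter _
      (Finset.Ico_subset_Ico_right ?_))
    have : (q + 1) * M = M * q + M := by ring
    omega
  have h3 : M.count p ≤ M := Nat.count_le _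
  have h1' : (q : ℝ) * M.count p ≤ ((Finset.Ico a (a + N)).filter p).card := by exact_mod_cast h1
  have h2' : (((Finset.Ico a (a + N)).filter p).card : ℝ) ≤ (q + 1) * M.count p := by
    exact_mod_cast h2
  have h3' : (M.count p : ℝ) ≤ M := by exact_mod_cast h3
  have hM' : (0 : ℝ) < M := by exact_mod_cast hM
  have h4 : (q : ℝ) * M ≤ N := by
    exact_mod_cast (by omega : q * M ≤ N)
  have h5 : (N : ℝ) ≤ (q + 1) * M := by
    have : (q + 1) * M = M * q + M := by ring
    exact_mod_cast (by omega : N ≤ (q + 1) * M)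
  have hc : (0 : ℝ) ≤ M.count p := by positivity
  have e : (N : ℝ) * (M.count p / M) = (N / M) * M.count p := by ring
  have h6 : (q : ℝ) ≤ N / M := by rwa [le_div_iff₀ hM']
  have h7 : (N : ℝ) / M ≤ q + 1 := by rwa [div_le_iff₀ hM']
  have h8 := mul_le_mul_of_nonneg_right h6 hc
  have h9 := mul_le_mul_of_nonneg_right h7 hc
  rw [e, abs_le]
  constructor <;> linarith

/-- By the Chinese remainder theorem, one period corresponds to the product of the residue rings. -/
theorem count_forall_mem_residues (T : Finset ℕ) (hT : ∀ p ∈ T, p.Prime)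
    (B : ∀ p : ℕ, Finset (ZMod p)) :
    (∏ p ∈ T, p).count (fun n => ∀ p ∈ T, (n : ZMod p) ∈ B p) = ∏ p ∈ T, (B p).card := by
  have hco : Pairwise (Function.onFun Nat.Coprime fun i : T => (i : ℕ)) := by
    intro i j hij
    exact (Nat.coprime_primes (hT i i.2) (hT j j.2)).2 fun h => hij (Subtype.ext h)
  have hM : (∏ p ∈ T, p) = ∏ i : T, (i : ℕ) := (Finset.prod_coe_sort T fun p => p).symm
  rw [hM, ← Finset.prod_coe_sort T, Nat.count_eq_card_filter_range, ← Fintype.card_piFinset]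
  set M := ∏ i : T, (i : ℕ)
  have hM0 : 0 < M := Finset.prod_pos fun i _ => (hT i i.2).pos
  have : NeZero M := ⟨hM0.ne'⟩
  have happ : ∀ (n : ℕ) (i : T), ZMod.prodEquivPi (fun i : T => (i : ℕ)) hco (n : ZMod M) i = n :=
    fun n i => by rw [map_natCast, Pi.natCast_apply]
  refine Finset.card_bij (fun n _ (i : T) => (n : ZMod (i : ℕ))) ?_ ?_ ?_
  · intro n hn
    rw [Finset.mem_filter] at hn
    rw [Fintype.mem_piFinset]
    exact fun i => hn.2 i i.2
  · intro n hn n' hn' h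
    rw [Finset.mem_filter, Finset.mem_range] at hn hn'
    have : (n : ZMod M) = n' := by
      apply (ZMod.prodEquivPi (fun i : T => (i : ℕ)) hco).injective
      funext i
      rw [happ, happ]
      exact congrFun h i
    rw [ZMod.natCast_eq_natCast_iff'] at this
    rwa [Nat.mod_eq_of_lt hn.1, Nat.mod_eq_of_lt hn'.1] at this
  · intro f hf
    rw [Fintype.mem_piFinset] at hf
    set b := (ZMod.prodEquivPi (fun i : T => (i : ℕ)) hco).symm f with hb
    have hbv : ((b.val : ℕ) : ZMod M) = b := ZMod.natCast_zmod_val b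
    have h1 : ∀ i : T, ((b.val : ℕ) : ZMod (i : ℕ)) = f i := by
      intro i
      rw [← happ, hbv, hb, RingEquiv.apply_symm_apply]
    refine ⟨b.val, ?_, funext h1⟩
    rw [Finset.mem_filter, Finset.mem_range]
    refine ⟨ZMod.val_lt b, fun p hp => ?_⟩
    rw [h1 ⟨p, hp⟩]
    exact hf ⟨p, hp⟩

theorem abs_card_residues_sub_le (T : Finset ℕ) (hT : ∀ p ∈ T, p.Prime)
    (B : ∀ p : ℕ, Finset (ZMod p)) (a N : ℕ) :
    |(((Finset.Ico a (a + N)).filter fun n : ℕ => ∀ p ∈ T, (n : ZMod p) ∈ B p).card : ℝ) -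
      N * ∏ p ∈ T, ((B p).card / p : ℝ)| ≤ ∏ p ∈ T, (p : ℝ) := by
  have hper : Function.Periodic (fun n : ℕ => ∀ p ∈ T, (n : ZMod p) ∈ B p) (∏ p ∈ T, p) := by
    intro n
    refine propext (forall₂_congr fun p hp => ?_)
    have : ((∏ p ∈ T, p : ℕ) : ZMod p) = 0 :=
      (ZMod.natCast_eq_zero_iff _ _).2 (Finset.dvd_prod_of_mem _ hp)
    rw [Nat.cast_add, this, add_zero]
  have := abs_card_filter_Ico_sub_le _ (Finset.prod_pos fun p hp => (hT p hp).pos) hper a N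
  rw [count_forall_mem_residues T hT B] at this
  rw [Nat.cast_prod, Nat.cast_prod] at this
  rwa [Finset.prod_div_distrib]

/-- Selberg's upper bound sieve: remove the residue classes `B p` for `p ∈ P`. -/
theorem selberg_sieve (P : Finset ℕ) (hP : ∀ p ∈ P, p.Prime) (B : ∀ p : ℕ, Finset (ZMod p))
    (hB : ∀ p ∈ P, (B p).Nonempty) (hB' : ∀ p ∈ P, (B p).card < p) (y : ℕ) (hy : 1 ≤ y)
    (a N : ℕ) :
    (((Finset.Ico a (a + N)).filter fun n : ℕ => ∀ p ∈ P, (n : ZMod p) ∉ B p).card : ℝ) ≤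
      N * (∑ L ∈ P.powerset with ∏ p ∈ L, p ≤ y,
        ∏ p ∈ L, ((B p).card / p : ℝ) / (1 - (B p).card / p))⁻¹ + (y : ℝ) ^ 6 := by
  classical
  set h : ℕ → ℝ := fun p => (B p).card / p with hh
  have ppos : ∀ p ∈ P, (0 : ℝ) < p := fun p hp => by exact_mod_cast (hP p hp).pos
  have bpos : ∀ p ∈ P, (1 : ℝ) ≤ (B p).card := fun p hp => by
    exact_mod_cast Finset.card_pos.2 (hB p hp)
  have h0 : ∀ p ∈ P, 0 < h p := fun p hp => div_pos (by linarith [bpos p hp]) (ppos p hp)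
  have h1 : ∀ p ∈ P, h p < 1 := fun p hp => by
    rw [hh, div_lt_one (ppos p hp)]
    exact_mod_cast hB' p hp
  have hinv : ∀ p ∈ P, (h p)⁻¹ ≤ p := fun p hp => by
    rw [hh, inv_div]
    exact div_le_self (ppos p hp).le (bpos p hp)
  set D := P.powerset.filter fun L => ∏ p ∈ L, p ≤ y with hDdef
  have hDP : ∀ L ∈ D, L ⊆ P := fun L hL => Finset.mem_powerset.1 (Finset.mem_filter.1 hL).1
  obtain ⟨w, hw1, hw0, hwb, hwS⟩ := exists_selberg_weights P h h0 h1 D hDP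
    (by
      intro L hL T hTL
      refine Finset.mem_filter.2 ⟨Finset.mem_powerset.2 (hTL.trans (hDP L hL)), ?_⟩
      refine le_trans ?_ (Finset.mem_filter.1 hL).2
      exact Finset.prod_le_prod_of_subset_of_one_le' hTL
        fun p hp _ => (hP p (hDP L hL hp)).one_le)
    (Finset.mem_filter.2 ⟨by simp, by simpa using hy⟩)
  have hDy : ∀ T ∈ D, ∏ p ∈ T, (p : ℝ) ≤ y := fun T hT => by
    rw [← Nat.cast_prod]
    exact_mod_cast (Finset.mem_filter.1 hT).2
  have hwy : ∀ T ∈ D, |w T| ≤ y := fun T hT =>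
    (hwb T hT).trans <| le_trans (Finset.prod_le_prod
      (fun p hp => (inv_pos.2 (h0 p (hDP T hT hp))).le)
      (fun p hp => hinv p (hDP T hT hp))) (hDy T hT)
  -- A set of primes is determined by its product, so `D` embeds in `[1, y]`.
  have hDcard : (D.card : ℝ) ≤ y := by
    have : D.card ≤ (Finset.Icc 1 y).card := by
      refine Finset.card_le_card_of_injOn (fun L => ∏ p ∈ L, p) ?_ ?_
      · intro L hL
        exact Finset.mem_coe.2 (Finset.mem_Icc.2
          ⟨Finset.prod_pos fun p hp => (hP p (hDP L hL hp)).pos, (Finset.mem_filter.1 hL).2⟩)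
      · intro L hL M hM hLM
        have := congrArg Nat.primeFactors hLM
        simp only at this
        rwa [Nat.primeFactors_prod fun p hp => hP p (hDP L hL hp),
          Nat.primeFactors_prod fun p hp => hP p (hDP M hM hp)] at this
    rw [Nat.card_Icc, Nat.add_sub_cancel] at this
    exact_mod_cast this
  set I := Finset.Ico a (a + N)
  set c : Finset ℕ → ℝ := fun T => ((I.filter fun n : ℕ => ∀ p ∈ T, (n : ZMod p) ∈ B p).card : ℝ)
  -- Since `w ∅ = 1`, the square equals 1 on sifted integers and is nonnegative elsewhere.
  have step1 : ((I.filter fun n : ℕ => ∀ p ∈ P, (n : ZMod p) ∉ B p).card : ℝ) ≤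
      ∑ n ∈ I, (∑ T ∈ P.powerset, if ∀ p ∈ T, (n : ZMod p) ∈ B p then w T else 0) ^ 2 := by
    rw [Finset.card_filter, Nat.cast_sum]
    refine Finset.sum_le_sum fun n _ => ?_
    by_cases hn : ∀ p ∈ P, (n : ZMod p) ∉ B p
    · rw [if_pos hn, Finset.sum_eq_single ∅]
      · simp [hw1]
      · intro T hT hT0
        obtain ⟨p, hp⟩ := Finset.nonempty_iff_ne_empty.2 hT0
        exact if_neg fun hall => hn p (Finset.mem_powerset.1 hT hp) (hall p hp)
      · intro h; simp at h
    · rw [if_neg hn]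
      simpa using sq_nonneg _
  have step2 : ∑ n ∈ I, (∑ T ∈ P.powerset, if ∀ p ∈ T, (n : ZMod p) ∈ B p then w T else 0) ^ 2 =
      ∑ T ∈ P.powerset, ∑ U ∈ P.powerset, w T * w U * c (T ∪ U) := by
    simp_rw [sq, Finset.sum_mul_sum]
    rw [Finset.sum_comm]
    refine Finset.sum_congr rfl fun T _ => ?_
    rw [Finset.sum_comm]
    refine Finset.sum_congr rfl fun U _ => ?_
    simp only [c]
    rw [Finset.card_filter, Nat.cast_sum, Finset.mul_sum]
    refine Finset.sum_congr rfl fun n _ => ?_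
    by_cases hT : ∀ p ∈ T, (n : ZMod p) ∈ B p <;> by_cases hU : ∀ p ∈ U, (n : ZMod p) ∈ B p
    · rw [if_pos hT, if_pos hU, if_pos]
      · simp
      · exact fun p hp => (Finset.mem_union.1 hp).elim (hT p) (hU p)
    · rw [if_neg hU, if_neg (c := ∀ p ∈ T ∪ U, _) (fun h => hU fun p hp => h p (Finset.mem_union_right _ hp))]
      simp
    · rw [if_neg hT, if_neg (c := ∀ p ∈ T ∪ U, _) (fun h => hT fun p hp => h p (Finset.mem_union_left _ hp))]
      simp
    · rw [if_neg hT, if_neg (c := ∀ p ∈ T ∪ U, _) (fun h => hT fun p hp => h p (Finset.mem_union_left _ hp))]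
      simp
  have step3 : ∑ T ∈ P.powerset, ∑ U ∈ P.powerset, w T * w U * c (T ∪ U) =
      N * (∑ L ∈ D, ∏ p ∈ L, h p / (1 - h p))⁻¹ +
      ∑ T ∈ D, ∑ U ∈ D, w T * w U * (c (T ∪ U) - N * ∏ p ∈ T ∪ U, h p) := by
    have hsub : ∑ T ∈ D, ∑ U ∈ D, w T * w U * (c (T ∪ U) - N * ∏ p ∈ T ∪ U, h p) =
        ∑ T ∈ P.powerset, ∑ U ∈ P.powerset,
          w T * w U * (c (T ∪ U) - N * ∏ p ∈ T ∪ U, h p) := by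
      rw [Finset.sum_subset (Finset.filter_subset _ _)]
      · refine Finset.sum_congr rfl fun T _ => ?_
        refine Finset.sum_subset (Finset.filter_subset _ _) fun U _ hU => ?_
        rw [hw0 U hU]; simp
      · intro T _ hT
        rw [hw0 T hT]; simp
    rw [hsub, ← hwS, Finset.mul_sum, ← Finset.sum_add_distrib]
    refine Finset.sum_congr rfl fun T _ => ?_
    rw [Finset.mul_sum, ← Finset.sum_add_distrib]
    refine Finset.sum_congr rfl fun U _ => ?_
    ring
  -- Each weight costs `y` and the modulus of `T ∪ U` costs `y ^ 2`; the number of pairs then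
  -- contributes another `y ^ 2`, giving `y ^ 6`.
  have step4 : ∑ T ∈ D, ∑ U ∈ D, w T * w U * (c (T ∪ U) - N * ∏ p ∈ T ∪ U, h p) ≤
      ∑ T ∈ D, ∑ U ∈ D, (y : ℝ) ^ 4 := by
    refine Finset.sum_le_sum fun T hT => Finset.sum_le_sum fun U hU => ?_
    refine (le_abs_self _).trans ?_
    rw [abs_mul, abs_mul]
    have hTU : |c (T ∪ U) - N * ∏ p ∈ T ∪ U, h p| ≤ y * y := by
      refine (abs_card_residues_sub_le (T ∪ U) (fun p hp => (Finset.mem_union.1 hp).elim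
        (fun hp => hP p (hDP T hT hp)) (fun hp => hP p (hDP U hU hp))) B a N).trans ?_
      refine le_trans ?_ (mul_le_mul (hDy T hT) (hDy U hU) (by positivity) (by positivity))
      rw [← Finset.prod_union_inter]
      refine le_mul_of_one_le_right (by positivity) ?_
      rw [← Nat.cast_prod]
      exact_mod_cast Finset.prod_pos
        (fun p hp => (hP p (hDP T hT (Finset.mem_inter.1 hp).1)).pos)
    calc |w T| * |w U| * |c (T ∪ U) - N * ∏ p ∈ T ∪ U, h p|
        ≤ y * y * (y * y) := by
          gcongr
          exacts [hwy T hT, hwy U hU]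
      _ = (y : ℝ) ^ 4 := by ring
  have step5 : ∑ T ∈ D, ∑ U ∈ D, (y : ℝ) ^ 4 ≤ (y : ℝ) ^ 6 := by
    simp only [Finset.sum_const, nsmul_eq_mul]
    calc (D.card : ℝ) * (D.card * (y : ℝ) ^ 4) ≤ y * (y * (y : ℝ) ^ 4) := by gcongr
      _ = (y : ℝ) ^ 6 := by ring
  linarith

/-! ### Chebyshev and Mertens type estimates -/

/-- Only the first term `z / p` of Legendre's formula for the exponent of `p` in `z!` is kept. -/
theorem prod_pow_div_dvd_factorial (z : ℕ) :
    ∏ p ∈ Nat.primesLE z, p ^ (z / p) ∣ z.factorial := by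
  refine Finset.prod_dvd_of_isRelPrime ?_ ?_
  · intro p hp q hq hpq
    exact Nat.coprime_iff_isRelPrime.1 (((Nat.coprime_primes (Nat.prime_of_mem_primesLE hp)
      (Nat.prime_of_mem_primesLE hq)).2 hpq).pow _ _)
  · intro p hp
    have hp' := Nat.prime_of_mem_primesLE hp
    rw [hp'.pow_dvd_factorial_iff (b := Nat.log p z + 2) (by omega)]
    refine le_trans (by simp) (Finset.single_le_sum (f := fun i => z / p ^ i)
      (fun i _ => Nat.zero_le _) (Finset.mem_Ico.2 ⟨le_refl 1, by omega⟩))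

/-- Logarithms of the preceding divisibility and `z! ≤ z ^ z` bound the sum with `z / p` rounded
down; Chebyshev's `θ(z) ≤ z log 4` pays for the rounding. -/
theorem sum_primesLE_log_div_le (z : ℕ) (hz : 1 ≤ z) :
    ∑ p ∈ Nat.primesLE z, Real.log p / p ≤ Real.log z + Real.log 4 := by
  have hz' : (0 : ℝ) < z := by exact_mod_cast hz
  have h1 : ∑ p ∈ Nat.primesLE z, ((z / p : ℕ) : ℝ) * Real.log p ≤ z * Real.log z := by
    have h := Nat.le_of_dvd z.factorial_pos (prod_pow_div_dvd_factorial z)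
    have h' := h.trans z.factorial_le_pow
    have h2 : ((∏ p ∈ Nat.primesLE z, p ^ (z / p) : ℕ) : ℝ) ≤ (z : ℝ) ^ z := by exact_mod_cast h'
    have hpos : (0 : ℝ) < ((∏ p ∈ Nat.primesLE z, p ^ (z / p) : ℕ) : ℝ) := by
      exact_mod_cast Finset.prod_pos fun p hp => pow_pos (Nat.prime_of_mem_primesLE hp).pos _
    have h3 := Real.log_le_log hpos h2
    rw [Real.log_pow, Nat.cast_prod, Real.log_prod] at h3
    · refine le_trans (le_of_eq (Finset.sum_congr rfl fun p _ => ?_)) h3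
      rw [Nat.cast_pow, Real.log_pow]
    · intro p hp
      have := (Nat.prime_of_mem_primesLE hp).pos
      positivity
  have h2 : ∑ p ∈ Nat.primesLE z, Real.log p ≤ Real.log 4 * z := by
    rw [← Chebyshev.theta_eq_sum_primesLE_log]
    exact Chebyshev.theta_le_log4_mul_x hz'.le
  have h3 : ∀ p ∈ Nat.primesLE z, z * (Real.log p / p) ≤
      ((z / p : ℕ) : ℝ) * Real.log p + Real.log p := by
    intro p hp
    have hp' := (Nat.prime_of_mem_primesLE hp).pos
    have hp'' : (0 : ℝ) < p := by exact_mod_cast hp'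
    have h4 : (z : ℝ) / p ≤ ((z / p : ℕ) : ℝ) + 1 := by
      rw [← Nat.floor_div_eq_div (K := ℝ)]
      exact (Nat.lt_floor_add_one _).le
    have h5 : 0 ≤ Real.log p := Real.log_natCast_nonneg p
    calc z * (Real.log p / p) = z / p * Real.log p := by ring
      _ ≤ (((z / p : ℕ) : ℝ) + 1) * Real.log p := by gcongr
      _ = _ := by ring
  have h4 := Finset.sum_le_sum h3
  rw [← Finset.mul_sum, Finset.sum_add_distrib] at h4
  refine le_of_mul_le_mul_left ?_ hz'
  linarith [mul_comm (Real.log 4) (z : ℝ), mul_add (z : ℝ) (Real.log z) (Real.log 4)]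

/-- The Euler product expands into the sum of `1 / n` over `z`-smooth `n`, which includes every `n ≤
z` and so dominates the harmonic sum. -/
theorem log_le_prod_primesLE (z : ℕ) :
    Real.log z ≤ ∏ p ∈ Nat.primesLE z, (1 - 1 / (p : ℝ))⁻¹ := by
  let f : ℕ →* ℝ :=
    { toFun := fun n => (n : ℝ)⁻¹
      map_one' := by simp
      map_mul' := fun a b => by simp [mul_comm] }
  have hf : ∀ n, f n = (n : ℝ)⁻¹ := fun n => rfl
  have h1 := (EulerProduct.summable_and_hasSum_smoothNumbers_prod_primesBelow_geometric (f := f)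
    (by
      intro p hp
      rw [hf, Real.norm_of_nonneg (by positivity)]
      exact inv_lt_one_of_one_lt₀ (by exact_mod_cast hp.one_lt)) (z + 1)).2
  have h2 : Real.log z ≤ ∑ n ∈ Finset.Icc 1 z, f n := by
    rcases Nat.eq_zero_or_pos z with rfl | hz
    · simp
    · refine le_trans (Real.log_le_log (by exact_mod_cast hz) (y := ((z + 1 : ℕ) : ℝ)) ?_) ?_
      · push_cast; linarith
      · refine (log_add_one_le_harmonic z).trans (le_of_eq ?_)
        rw [harmonic_eq_sum_Icc]
        push_cast
        rfl
  simp only [one_div]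
  refine h2.trans ?_
  have hmem : ∀ n ∈ Finset.Icc 1 z, n ∈ Nat.smoothNumbers (z + 1) := by
    intro n hn
    rw [Finset.mem_Icc] at hn
    rw [Nat.mem_smoothNumbers']
    intro p _ hpn
    have := Nat.le_of_dvd (by omega) hpn
    omega
  rw [← Finset.sum_subtype_of_mem (p := (· ∈ Nat.smoothNumbers (z + 1))) f hmem]
  exact sum_le_hasSum _ (fun i _ => by rw [hf]; positivity) h1

theorem inv_one_sub_inv_le_exp {p : ℕ} (hp : 2 ≤ p) :
    (1 - 1 / (p : ℝ))⁻¹ ≤ Real.exp (2 / p) := by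
  have hp' : (2 : ℝ) ≤ p := by exact_mod_cast hp
  have h : (1 - 1 / (p : ℝ))⁻¹ ≤ 2 / p + 1 := by
    have h0 : 0 < 1 - 1 / (p : ℝ) := by
      rw [sub_pos, div_lt_one] <;> linarith
    rw [inv_le_iff_one_le_mul₀ h0]
    have : (2 / (p : ℝ) + 1) * (1 - 1 / p) = 1 + (p - 2) / p ^ 2 := by
      field_simp
      ring
    rw [this]
    have : 0 ≤ ((p : ℝ) - 2) / p ^ 2 := div_nonneg (by linarith) (by positivity)
    linarith
  exact h.trans (Real.add_one_le_exp _)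

theorem one_sub_inv_pos {p : ℕ} (hp : 2 ≤ p) : 0 < 1 - 1 / (p : ℝ) := by
  have hp' : (2 : ℝ) ≤ p := by exact_mod_cast hp
  rw [sub_pos, div_lt_one] <;> linarith

theorem one_le_inv_one_sub_inv {p : ℕ} (hp : 2 ≤ p) : 1 ≤ (1 - 1 / (p : ℝ))⁻¹ := by
  refine (one_le_inv₀ (one_sub_inv_pos hp)).2 ?_
  have : 0 ≤ 1 / (p : ℝ) := by positivity
  linarith

/-- For new primes `p ≥ n`, `1 / p ≤ (log p / p) / log n`, and the sum of `log p / p` up to `n ^ 2`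
is at most `4 log n`. Squaring the range thus costs a bounded factor. -/
theorem prod_primesLE_sq_le (n : ℕ) (hn : 2 ≤ n) :
    ∏ p ∈ Nat.primesLE (n ^ 2), (1 - 1 / (p : ℝ))⁻¹ ≤
      (∏ p ∈ Nat.primesLE n, (1 - 1 / (p : ℝ))⁻¹) * Real.exp 8 := by
  have hsub : Nat.primesLE n ⊆ Nat.primesLE (n ^ 2) :=
    Nat.primesLE_mono (Nat.le_self_pow two_ne_zero n)
  have hlog : 0 < Real.log n := Real.log_pos (by exact_mod_cast hn)
  rw [← Finset.prod_sdiff hsub, mul_comm]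
  refine mul_le_mul_of_nonneg_left ?_ (Finset.prod_nonneg fun p hp =>
    zero_le_one.trans (one_le_inv_one_sub_inv (Nat.two_le_of_mem_primesLE hp)))
  refine (Finset.prod_le_prod (fun p hp => ?_) (fun p hp => inv_one_sub_inv_le_exp ?_)).trans ?_
  · exact zero_le_one.trans (one_le_inv_one_sub_inv
      (Nat.two_le_of_mem_primesLE (Finset.mem_sdiff.1 hp).1))
  · exact Nat.two_le_of_mem_primesLE (Finset.mem_sdiff.1 hp).1
  rw [← Real.exp_sum, Real.exp_le_exp]
  have h1 : ∀ p ∈ Nat.primesLE (n ^ 2) \ Nat.primesLE n,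
      2 / (p : ℝ) ≤ 2 / Real.log n * (Real.log p / p) := by
    intro p hp
    rw [Finset.mem_sdiff, Nat.mem_primesLE, Nat.mem_primesLE] at hp
    have hpn : n ≤ p := by
      by_contra h
      exact hp.2 ⟨by omega, hp.1.2⟩
    have hp0 : (0 : ℝ) < p := by exact_mod_cast hp.1.2.pos
    have : Real.log n ≤ Real.log p :=
      Real.log_le_log (by exact_mod_cast (by omega : 0 < n)) (by exact_mod_cast hpn)
    rw [div_mul_div_comm, div_le_div_iff₀ hp0 (by positivity)]
    nlinarith
  refine (Finset.sum_le_sum h1).trans ?_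
  rw [← Finset.mul_sum]
  have h2 : ∑ p ∈ Nat.primesLE (n ^ 2) \ Nat.primesLE n, Real.log p / p ≤
      Real.log (n ^ 2 : ℕ) + Real.log 4 :=
    (Finset.sum_le_sum_of_subset_of_nonneg Finset.sdiff_subset fun p _ _ =>
      div_nonneg (Real.log_natCast_nonneg p) (by positivity)).trans
      (sum_primesLE_log_div_le _ (Nat.one_le_pow _ _ (by omega)))
  have h3 : Real.log 4 ≤ 2 * Real.log n := by
    have : (4 : ℝ) = 2 ^ 2 := by norm_num
    rw [this, Real.log_pow]
    have : Real.log 2 ≤ Real.log n := Real.log_le_log (by norm_num) (by exact_mod_cast hn)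
    push_cast; linarith
  rw [Nat.cast_pow, Real.log_pow] at h2
  push_cast at h2
  calc 2 / Real.log n * _ ≤ 2 / Real.log n * (4 * Real.log n) := by
        gcongr
        linarith
    _ = 8 := by field_simp; norm_num

theorem prod_primesLE_two_pow_two_pow_le (i : ℕ) :
    ∏ p ∈ Nat.primesLE (2 ^ 2 ^ i), (1 - 1 / (p : ℝ))⁻¹ ≤ 2 * Real.exp 8 ^ i := by
  induction i with
  | zero =>
    have : Nat.primesLE (2 ^ 2 ^ 0) = {2} := by decide
    rw [this]
    norm_num
  | succ i ih =>
    rw [pow_succ 2 i, pow_mul]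
    refine (prod_primesLE_sq_le _ (Nat.le_self_pow (by positivity) 2)).trans ?_
    rw [pow_succ, ← mul_assoc]
    gcongr

/-- A crude form of the upper bound in Mertens' third theorem. -/
theorem prod_primesLE_le_log_pow (z : ℕ) (hz : 2 ≤ z) :
    ∏ p ∈ Nat.primesLE z, (1 - 1 / (p : ℝ))⁻¹ ≤ 2 * (8 * Real.log z) ^ 12 := by
  -- The number `i` of squarings from 2 needed to reach `z` satisfies `2 ^ i ≤ 8 log z`; as `exp 8 ≤
  -- 2 ^ 12`, the accumulated cost `exp 8 ^ i` is at most the 12th power of this.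
  set j := Nat.clog 2 z with hj
  set i := Nat.clog 2 j with hi
  have h1 : z ≤ 2 ^ 2 ^ i := (Nat.le_pow_clog one_lt_two z).trans
    (Nat.pow_le_pow_right (by norm_num) (Nat.le_pow_clog one_lt_two _))
  have hlz : Real.log 2 ≤ Real.log z := Real.log_le_log (by norm_num) (by exact_mod_cast hz)
  have hl2 := Real.log_two_gt_d9
  have hj1 : 1 ≤ j := Nat.clog_pos one_lt_two hz
  have h2 : (j : ℝ) ≤ 4 * Real.log z := by
    have h := (Nat.pow_pred_clog_lt_self one_lt_two (show 1 < z by omega)).le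
    rw [← hj] at h
    have h' : ((2 : ℝ) ^ (j - 1)) ≤ z := by exact_mod_cast h
    have h3 := Real.log_le_log (by positivity) h'
    rw [Real.log_pow, Nat.cast_sub hj1] at h3
    push_cast at h3
    have : (j : ℝ) * Real.log 2 ≤ 2 * Real.log z := by linarith
    have hj0 : (0 : ℝ) ≤ j := by positivity
    nlinarith
  have h3 : (2 : ℝ) ^ i ≤ 8 * Real.log z := by
    rcases hj1.eq_or_lt with h | h
    · have : i = 0 := by rw [hi, ← h]; simp
      rw [this, pow_zero]
      linarith
    · have h' := (Nat.pow_pred_clog_lt_self one_lt_two h).le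
      have hi1 : 1 ≤ i := Nat.clog_pos one_lt_two h
      rw [← hi] at h'
      have h4 : ((2 : ℝ) ^ (i - 1)) ≤ j := by exact_mod_cast h'
      have h5 : (2 : ℝ) ^ i = 2 * 2 ^ (i - 1) := by
        rw [← pow_succ', Nat.sub_add_cancel hi1]
      linarith
  have h4 : Real.exp 8 ≤ 2 ^ 12 := by
    have e : Real.exp 8 = Real.exp 1 ^ 8 := by rw [← Real.exp_nat_mul]; norm_num
    rw [e]
    have h := Real.exp_one_lt_d9.le
    calc Real.exp 1 ^ 8 ≤ 2.75 ^ 8 := by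
          gcongr
          linarith
      _ ≤ 2 ^ 12 := by norm_num
  calc ∏ p ∈ Nat.primesLE z, (1 - 1 / (p : ℝ))⁻¹
      ≤ ∏ p ∈ Nat.primesLE (2 ^ 2 ^ i), (1 - 1 / (p : ℝ))⁻¹ := by
        refine Finset.prod_le_prod_of_subset_of_one_le (Nat.primesLE_mono h1) ?_ ?_
        · exact fun p hp => zero_le_one.trans
            (one_le_inv_one_sub_inv (Nat.two_le_of_mem_primesLE hp))
        · exact fun p hp _ => one_le_inv_one_sub_inv (Nat.two_le_of_mem_primesLE hp)
    _ ≤ 2 * Real.exp 8 ^ i := prod_primesLE_two_pow_two_pow_le i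
    _ ≤ 2 * (2 ^ 12) ^ i := by gcongr
    _ = 2 * (2 ^ i) ^ 12 := by rw [← pow_mul, ← pow_mul, mul_comm 12]
    _ ≤ 2 * (8 * Real.log z) ^ 12 := by gcongr

/-! ### Lower bound for the truncated Selberg sum -/

/-- Rankin's trick: the Selberg sum truncated at `z ^ (6k + 1)` retains half of the full product. -/
theorem half_prod_le_selberg_sum (k z : ℕ) (hz : 2 ≤ z) (h : ℕ → ℝ)
    (h0 : ∀ p ∈ Nat.primesLE z, 0 < h p) (h1 : ∀ p ∈ Nat.primesLE z, h p < 1)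
    (hk : ∀ p ∈ Nat.primesLE z, h p ≤ k / p) :
    1 / 2 * ∏ p ∈ Nat.primesLE z, (1 - h p)⁻¹ ≤
      ∑ L ∈ (Nat.primesLE z).powerset with ∏ p ∈ L, p ≤ z ^ (6 * k + 1),
        ∏ p ∈ L, h p / (1 - h p) := by
  set P := Nat.primesLE z with hP
  set W := ∏ p ∈ P, (1 - h p)⁻¹ with hW
  have hlog : 0 < Real.log z := Real.log_pos (by exact_mod_cast hz)
  have Wpos : 0 < W := Finset.prod_pos fun p hp => inv_pos.2 (sub_pos.2 (h1 p hp))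
  have gpos : ∀ p ∈ P, 0 < h p / (1 - h p) := fun p hp =>
    div_pos (h0 p hp) (sub_pos.2 (h1 p hp))
  have hfull : ∑ L ∈ P.powerset, ∏ p ∈ L, h p / (1 - h p) = W := by
    rw [← Finset.prod_add_one]
    refine Finset.prod_congr rfl fun p hp => ?_
    have := sub_pos.2 (h1 p hp)
    field_simp
    ring
  -- `exp (u p) = p ^ (1 / log z)` is Rankin's weight: for a set of primes with product above `z ^
  -- (6k + 1)` the weights multiply to at least `exp (6k + 1)`.
  set u : ℕ → ℝ := fun p => Real.log p / Real.log z with hu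
  have hu0 : ∀ p, 0 ≤ u p := fun p => div_nonneg (Real.log_natCast_nonneg p) hlog.le
  have htail : ∑ L ∈ P.powerset with ¬ ∏ p ∈ L, p ≤ z ^ (6 * k + 1), ∏ p ∈ L, h p / (1 - h p) ≤
      1 / 2 * W := by
    calc ∑ L ∈ P.powerset with ¬ ∏ p ∈ L, p ≤ z ^ (6 * k + 1), ∏ p ∈ L, h p / (1 - h p)
        ≤ ∑ L ∈ P.powerset with ¬ ∏ p ∈ L, p ≤ z ^ (6 * k + 1),
            Real.exp (-(6 * k + 1)) * ∏ p ∈ L, (h p / (1 - h p) * Real.exp (u p)) := by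
          refine Finset.sum_le_sum fun L hL => ?_
          rw [Finset.mem_filter, Finset.mem_powerset, not_le] at hL
          rw [Finset.prod_mul_distrib, mul_left_comm, ← Real.exp_sum, ← Real.exp_add]
          refine le_mul_of_one_le_right
            (Finset.prod_nonneg fun p hp => (gpos p (hL.1 hp)).le) ?_
          rw [Real.one_le_exp_iff, hu, ← Finset.sum_div, ← Real.log_prod]
          · have h2 : ((z : ℝ) ^ (6 * k + 1)) ≤ ∏ p ∈ L, (p : ℝ) := by
              rw [← Nat.cast_prod]
              exact_mod_cast hL.2.le
            have h3 := Real.log_le_log (pow_pos (by exact_mod_cast (by omega : 0 < z)) _) h2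
            rw [Real.log_pow, ← le_div_iff₀ hlog] at h3
            push_cast at h3
            linarith
          · intro p hp
            have := (Nat.prime_of_mem_primesLE (hL.1 hp)).pos
            positivity
      _ ≤ ∑ L ∈ P.powerset,
            Real.exp (-(6 * k + 1)) * ∏ p ∈ L, (h p / (1 - h p) * Real.exp (u p)) := by
          refine Finset.sum_le_sum_of_subset_of_nonneg (Finset.filter_subset _ _) fun L hL _ => ?_
          exact mul_nonneg (Real.exp_pos _).le (Finset.prod_nonneg fun p hp =>
            mul_nonneg (gpos p (Finset.mem_powerset.1 hL hp)).le (Real.exp_pos _).le)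
      _ = Real.exp (-(6 * k + 1)) * ∏ p ∈ P, (h p / (1 - h p) * Real.exp (u p) + 1) := by
          rw [← Finset.mul_sum, Finset.prod_add_one]
      _ ≤ Real.exp (-(6 * k + 1)) * ∏ p ∈ P,
            ((1 - h p)⁻¹ * Real.exp (2 * k / Real.log z * (Real.log p / p))) := by
          refine mul_le_mul_of_nonneg_left (Finset.prod_le_prod (fun p hp => ?_) fun p hp => ?_)
            (Real.exp_pos _).le
          · exact add_nonneg (mul_nonneg (gpos p hp).le (Real.exp_pos _).le) zero_le_one
          · have hp1 := sub_pos.2 (h1 p hp)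
            have hpp : (0 : ℝ) < p := by exact_mod_cast (Nat.prime_of_mem_primesLE hp).pos
            have hu1 : u p ≤ 1 := by
              rw [hu, div_le_one hlog]
              exact Real.log_le_log hpp (by exact_mod_cast Nat.le_of_mem_primesLE hp)
            have he : Real.exp (u p) - 1 ≤ 2 * u p := by
              have := (abs_le.1 (Real.abs_exp_sub_one_sub_id_le (x := u p)
                (by rw [abs_of_nonneg (hu0 p)]; exact hu1))).2
              nlinarith [hu0 p]
            have e : h p / (1 - h p) * Real.exp (u p) + 1 =
                (1 - h p)⁻¹ * (h p * (Real.exp (u p) - 1) + 1) := by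
              field_simp
              ring
            rw [e]
            refine mul_le_mul_of_nonneg_left ?_ (inv_pos.2 hp1).le
            refine (Real.add_one_le_exp _).trans (Real.exp_le_exp.2 ?_)
            calc h p * (Real.exp (u p) - 1) ≤ h p * (2 * u p) :=
                  mul_le_mul_of_nonneg_left he (h0 p hp).le
              _ ≤ k / p * (2 * u p) :=
                  mul_le_mul_of_nonneg_right (hk p hp) (mul_nonneg zero_le_two (hu0 p))
              _ = 2 * k / Real.log z * (Real.log p / p) := by simp only [hu]; ring
      _ = Real.exp (-(6 * k + 1)) * (W * Real.exp (2 * k / Real.log z *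
            ∑ p ∈ P, Real.log p / p)) := by
          rw [Finset.prod_mul_distrib, ← Real.exp_sum, ← Finset.mul_sum]
      -- Since `log 4 ≤ 2 log z`, the sum of `log p / p` is at most `3 log z`. The weights therefore
      -- cost `exp (6k)`, and the extra 1 in the exponent leaves `exp (-1) ≤ 1 / 2`.
      _ ≤ Real.exp (-(6 * k + 1)) * (W * Real.exp (6 * k)) := by
          refine mul_le_mul_of_nonneg_left (mul_le_mul_of_nonneg_left (Real.exp_le_exp.2 ?_)
            Wpos.le) (Real.exp_pos _).le
          have h3 : Real.log 4 ≤ 2 * Real.log z := by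
            have : (4 : ℝ) = 2 ^ 2 := by norm_num
            rw [this, Real.log_pow]
            have : Real.log 2 ≤ Real.log z := Real.log_le_log (by norm_num) (by exact_mod_cast hz)
            push_cast; linarith
          have h4 := sum_primesLE_log_div_le z (by omega)
          calc 2 * k / Real.log z * ∑ p ∈ P, Real.log p / p
              ≤ 2 * k / Real.log z * (3 * Real.log z) := by
                gcongr
                linarith
            _ = 6 * k := by field_simp; ring
      _ = Real.exp (-1) * W := by
          rw [mul_left_comm, ← Real.exp_add, mul_comm]
          congr 2
          ring
      _ ≤ 1 / 2 * W := by
          gcongr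
          rw [Real.exp_neg, ← one_div]
          have := Real.exp_one_gt_d9
          exact one_div_le_one_div_of_le (by norm_num) (by linarith)
  have hsplit := Finset.sum_filter_add_sum_filter_not P.powerset
    (fun L => ∏ p ∈ L, p ≤ z ^ (6 * k + 1)) (fun L => ∏ p ∈ L, h p / (1 - h p))
  rw [hfull] at hsplit
  linarith

/-! ### Euler factors and the size of the singular series -/

/-- The Euler factor of the singular series, as a function on all of `ℕ`. -/
noncomputable def eulerFactor {m : ℕ} (h : Fin (m + 1) → ℕ) (p : ℕ) : ℝ :=
  (1 - (residueCount h p : ℝ) / (p : ℝ)) / (1 - 1 / (p : ℝ)) ^ (m + 1)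

section EulerFactor

variable {m : ℕ} (h : Fin (m + 1) → ℕ)

theorem one_le_residueCount (p : ℕ) : 1 ≤ residueCount h p :=
  Finset.card_pos.2 (Finset.univ_nonempty.image _)

theorem residueCount_le (p : ℕ) : residueCount h p ≤ m + 1 :=
  Finset.card_image_le.trans (by simp)

theorem residueCount_le_self {p : ℕ} (hp : p.Prime) : residueCount h p ≤ p := by
  have : NeZero p := ⟨hp.ne_zero⟩
  exact (Finset.card_le_univ _).trans (by simp)

theorem eulerFactor_nonneg {p : ℕ} (hp : p.Prime) : 0 ≤ eulerFactor h p := by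
  have hp0 : (0 : ℝ) < p := by exact_mod_cast hp.pos
  refine div_nonneg (sub_nonneg.2 ?_) (pow_nonneg (one_sub_inv_pos hp.two_le).le _)
  rw [div_le_one hp0]
  exact_mod_cast residueCount_le_self h hp

theorem eulerFactor_le_pow {p : ℕ} (hp : p.Prime) :
    eulerFactor h p ≤ (1 - 1 / (p : ℝ))⁻¹ ^ m := by
  have h0 := one_sub_inv_pos hp.two_le
  have h1 : (1 : ℝ) ≤ residueCount h p := by exact_mod_cast one_le_residueCount h p
  have h2 : 1 - (residueCount h p : ℝ) / p ≤ 1 - 1 / (p : ℝ) := by gcongr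
  calc eulerFactor h p ≤ (1 - 1 / (p : ℝ)) / (1 - 1 / (p : ℝ)) ^ (m + 1) := by
        unfold eulerFactor; gcongr
    _ = (1 - 1 / (p : ℝ))⁻¹ ^ m := by
        rw [pow_succ, inv_pow]
        field_simp

/-- This is Bernoulli's inequality `1 - (m + 1) / p ≤ (1 - 1 / p) ^ (m + 1)`. -/
theorem eulerFactor_le_one {p : ℕ} (hp : p.Prime) (hr : residueCount h p = m + 1) :
    eulerFactor h p ≤ 1 := by
  have h0 := one_sub_inv_pos hp.two_le
  unfold eulerFactor
  rw [div_le_one (pow_pos h0 _), hr]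
  have h1 : (1 : ℝ) / p ≤ 1 := by linarith
  have := one_add_mul_le_pow (a := -(1 / (p : ℝ))) (by linarith) (m + 1)
  rw [← sub_eq_add_neg] at this
  refine le_trans (le_of_eq ?_) this
  ring

theorem exists_dvd_sub_of_residueCount_ne {p : ℕ} (hr : residueCount h p ≠ m + 1)
    (hh : StrictMono h) : ∃ i j, i < j ∧ p ∣ h j - h i := by
  by_contra hcon
  push Not at hcon
  apply hr
  unfold residueCount
  rw [Finset.card_image_of_injective, Finset.card_univ, Fintype.card_fin]
  have aux : ∀ i j, i < j → ((h i : ℕ) : ZMod p) ≠ h j := by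
    intro i j hij heq
    apply hcon i j hij
    rw [← ZMod.natCast_eq_zero_iff, Nat.cast_sub (hh hij).le, heq, sub_self]
  intro i j hij
  rcases lt_trichotomy i j with hlt | heq | hlt
  · exact absurd hij (aux i j hlt)
  · exact heq
  · exact absurd hij.symm (aux j i hlt)

/-- With `x = 1 / p` and `k = m + 1`, Bernoulli gives `(1 - x) ^ k * (1 + k x) ≤ (1 - x ^ 2) ^ k ≤
1`; multiplying by `1 - k x ≥ 0` produces the loss `(k x) ^ 2`. -/
theorem one_sub_le_eulerFactor {p : ℕ} (hp : p.Prime) (hmp : m + 1 ≤ p) :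
    1 - ((m : ℝ) + 1) ^ 2 * ((p : ℝ) ^ 2)⁻¹ ≤ eulerFactor h p := by
  have h0 := one_sub_inv_pos hp.two_le
  have hp0 : (0 : ℝ) < p := by exact_mod_cast hp.pos
  set x : ℝ := 1 / p with hx
  have hx0 : 0 < x := by positivity
  have hkx : ((m : ℝ) + 1) * x ≤ 1 := by
    rw [hx, mul_one_div, div_le_one hp0]
    exact_mod_cast hmp
  have e1 : ((m : ℝ) + 1) ^ 2 * ((p : ℝ) ^ 2)⁻¹ = (((m : ℝ) + 1) * x) ^ 2 := by
    rw [hx]; field_simp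
  have h1 : (1 - x) ^ (m + 1) * (1 + ((m : ℝ) + 1) * x) ≤ 1 := by
    have h2 : 1 + ((m : ℝ) + 1) * x ≤ (1 + x) ^ (m + 1) := by
      have := one_add_mul_le_pow (a := x) (by linarith) (m + 1)
      push_cast at this
      exact this
    calc (1 - x) ^ (m + 1) * (1 + ((m : ℝ) + 1) * x)
        ≤ (1 - x) ^ (m + 1) * (1 + x) ^ (m + 1) := by gcongr
      _ = (1 - x ^ 2) ^ (m + 1) := by rw [← mul_pow]; congr 1; ring
      _ ≤ 1 := pow_le_one₀ (by nlinarith) (by nlinarith)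
  unfold eulerFactor
  rw [le_div_iff₀ (pow_pos h0 _), e1]
  have h3 : (residueCount h p : ℝ) / p ≤ ((m : ℝ) + 1) * x := by
    rw [hx, mul_one_div]
    gcongr
    exact_mod_cast residueCount_le h p
  calc (1 - (((m : ℝ) + 1) * x) ^ 2) * (1 - x) ^ (m + 1)
      = (1 - x) ^ (m + 1) * (1 + ((m : ℝ) + 1) * x) * (1 - ((m : ℝ) + 1) * x) := by ring
    _ ≤ 1 * (1 - ((m : ℝ) + 1) * x) := by
        refine mul_le_mul_of_nonneg_right h1 (by linarith)
    _ ≤ 1 - (residueCount h p : ℝ) / p := by linarith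

theorem one_sub_sum_le_prod_one_sub {ι : Type*} (s : Finset ι) (a : ι → ℝ)
    (h0 : ∀ i ∈ s, 0 ≤ a i) (h1 : ∀ i ∈ s, a i ≤ 1) :
    1 - ∑ i ∈ s, a i ≤ ∏ i ∈ s, (1 - a i) := by
  classical
  induction s using Finset.induction_on with
  | empty => simp
  | insert i s hi ih =>
    rw [Finset.sum_insert hi, Finset.prod_insert hi]
    have ih' := ih (fun j hj => h0 j (Finset.mem_insert_of_mem hj))
      (fun j hj => h1 j (Finset.mem_insert_of_mem hj))
    have hi0 := h0 i (Finset.mem_insert_self i s)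
    have hi1 := h1 i (Finset.mem_insert_self i s)
    have hs : 0 ≤ ∑ j ∈ s, a j :=
      Finset.sum_nonneg fun j hj => h0 j (Finset.mem_insert_of_mem hj)
    nlinarith [mul_le_mul_of_nonneg_left ih' (sub_nonneg.2 hi1), mul_nonneg hi0 hs]

/-- The threshold makes the total loss at most `(m + 1) ^ 2 * ∑ 1 / p ^ 2 ≤ 1 / 2`, by the tail
bound `∑_{n > w} 1 / n ^ 2 ≤ 1 / w`. -/
theorem half_le_prod_eulerFactor (G : Finset ℕ) (hG : ∀ p ∈ G, p.Prime)
    (hw : ∀ p ∈ G, 2 * (m + 1) ^ 2 < p) : 1 / 2 ≤ ∏ p ∈ G, eulerFactor h p := by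
  set a : ℕ → ℝ := fun p => ((m : ℝ) + 1) ^ 2 * ((p : ℝ) ^ 2)⁻¹ with ha
  have ha0 : ∀ p, 0 ≤ a p := fun p => by positivity
  have hmp : ∀ p ∈ G, m + 1 ≤ p := fun p hp => by nlinarith [hw p hp]
  have ha1 : ∀ p ∈ G, a p ≤ 1 := fun p hp => by
    have hp0 : (0 : ℝ) < p := by exact_mod_cast (hG p hp).pos
    simp only [ha]
    rw [← div_eq_mul_inv, div_le_one (by positivity)]
    gcongr
    exact_mod_cast hmp p hp
  have hsum : ∑ p ∈ G, a p ≤ 1 / 2 := by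
    rw [ha, ← Finset.mul_sum]
    have hw0 : 2 * (m + 1) ^ 2 ≠ 0 := by positivity
    have h1 : ∑ p ∈ G, ((p : ℝ) ^ 2)⁻¹ ≤ ((2 * (m + 1) ^ 2 : ℕ) : ℝ)⁻¹ := by
      refine le_trans (Finset.sum_le_sum_of_subset_of_nonneg
        (t := Finset.Ioc (2 * (m + 1) ^ 2) (max (2 * (m + 1) ^ 2) (G.sup id))) ?_ ?_) ?_
      · intro p hp
        exact Finset.mem_Ioc.2 ⟨hw p hp, le_max_of_le_right (Finset.le_sup (f := id) hp)⟩
      · intro p _ _; positivity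
      · refine (sum_Ioc_inv_sq_le_sub hw0 (le_max_left _ _)).trans ?_
        rw [sub_le_self_iff]
        positivity
    calc ((m : ℝ) + 1) ^ 2 * ∑ p ∈ G, ((p : ℝ) ^ 2)⁻¹
        ≤ ((m : ℝ) + 1) ^ 2 * ((2 * (m + 1) ^ 2 : ℕ) : ℝ)⁻¹ := by gcongr
      _ = 1 / 2 := by push_cast; field_simp
  calc (1 : ℝ) / 2 ≤ 1 - ∑ p ∈ G, a p := by linarith
    _ ≤ ∏ p ∈ G, (1 - a p) := one_sub_sum_le_prod_one_sub G a (fun p _ => ha0 p) ha1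
    _ ≤ ∏ p ∈ G, eulerFactor h p := Finset.prod_le_prod
        (fun p hp => sub_nonneg.2 (ha1 p hp))
        (fun p hp => one_sub_le_eulerFactor h (hG p hp) (hmp p hp))

theorem prod_singularFactor_eq (F : Finset Nat.Primes) :
    ∏ p ∈ F, singularFactor h p =
      ∏ p ∈ F.image (fun q : Nat.Primes => (q : ℕ)), eulerFactor h p :=
  (Finset.prod_image (f := eulerFactor h) fun _ _ _ _ hab => Subtype.ext hab).symm

theorem prime_of_mem_image_coe {F : Finset Nat.Primes} {p : ℕ}
    (hp : p ∈ F.image fun q : Nat.Primes => (q : ℕ)) : p.Prime := by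
  obtain ⟨q, _, rfl⟩ := Finset.mem_image.1 hp
  exact q.2

variable {h}

/-- A prime above the largest offset divides no difference, so eventually each factor lies between
`1 - (m + 1) ^ 2 / p ^ 2` and 1. -/
theorem IsOffsetPattern.multipliable (hh : IsOffsetPattern h) :
    Multipliable (singularFactor h) := by
  have hfin : ∀ᶠ p : Nat.Primes in Filter.cofinite,
      max (m + 1) (h (Fin.last m) + 1) ≤ (p : ℕ) := by
    rw [Filter.eventually_cofinite]
    refine Set.Finite.of_finite_image (f := fun p : Nat.Primes => (p : ℕ))
      ((Set.finite_lt_nat (max (m + 1) (h (Fin.last m) + 1))).subset ?_)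
      Subtype.val_injective.injOn
    rintro _ ⟨p, hp, rfl⟩
    exact not_le.1 hp
  have hsum : Summable fun p : Nat.Primes => ((m : ℝ) + 1) ^ 2 * (((p : ℕ) : ℝ) ^ 2)⁻¹ := by
    refine Summable.mul_left _ ?_
    exact (Real.summable_nat_pow_inv.2 one_lt_two).comp_injective Subtype.val_injective
  have h1 : Summable fun p : Nat.Primes => singularFactor h p - 1 := by
    refine hsum.of_norm_bounded_eventually ?_
    filter_upwards [hfin] with p hp
    have hlow := one_sub_le_eulerFactor h p.2 ((le_max_left _ _).trans hp)
    have hup : eulerFactor h p ≤ 1 := by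
      refine eulerFactor_le_one h p.2 ?_
      by_contra hr
      obtain ⟨i, j, hij, hdvd⟩ := exists_dvd_sub_of_residueCount_ne h hr hh.2
      have h1 := hh.2 hij
      have h2 := Nat.le_of_dvd (by omega) hdvd
      have h3 := hh.2.monotone (Fin.le_last j)
      have h4 := (le_max_right _ _).trans hp
      omega
    have e : singularFactor h p = eulerFactor h p := rfl
    rw [Real.norm_eq_abs, e, abs_le]
    constructor <;> linarith [show 0 ≤ ((m : ℝ) + 1) ^ 2 * (((p : ℕ) : ℝ) ^ 2)⁻¹ by positivity]
  simpa using Real.multipliable_one_add_of_summable h1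

theorem IsOffsetPattern.half_prod_le_singularSeries (hh : IsOffsetPattern h) {z : ℕ}
    (hz : 2 * (m + 1) ^ 2 ≤ z) :
    1 / 2 * ∏ p ∈ Nat.primesLE z, eulerFactor h p ≤ singularSeries h := by
  refine ge_of_tendsto hh.multipliable.hasProd ?_
  filter_upwards [Filter.eventually_ge_atTop ((Nat.primesLE z).subtype Nat.Prime)] with F hF
  change 1 / 2 * _ ≤ ∏ p ∈ F, singularFactor h p
  rw [prod_singularFactor_eq]
  set G := F.image fun q : Nat.Primes => (q : ℕ) with hG
  have hsub : Nat.primesLE z ⊆ G := by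
    intro p hp
    exact Finset.mem_image.2 ⟨⟨p, Nat.prime_of_mem_primesLE hp⟩,
      hF (Finset.mem_subtype.2 hp), rfl⟩
  rw [← Finset.prod_sdiff hsub]
  refine mul_le_mul_of_nonneg_right ?_
    (Finset.prod_nonneg fun p hp => eulerFactor_nonneg h (Nat.prime_of_mem_primesLE hp))
  refine half_le_prod_eulerFactor h _
    (fun p hp => prime_of_mem_image_coe (Finset.mem_sdiff.1 hp).1) fun p hp => ?_
  rw [Finset.mem_sdiff, Nat.mem_primesLE] at hp
  have := prime_of_mem_image_coe hp.1
  by_contra hcon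
  exact hp.2 ⟨by omega, this⟩

theorem IsOffsetPattern.singularSeries_nonneg (hh : IsOffsetPattern h) : 0 ≤ singularSeries h :=
  le_trans (mul_nonneg (by norm_num) (Finset.prod_nonneg fun p hp =>
    eulerFactor_nonneg h (Nat.prime_of_mem_primesLE hp)))
    (hh.half_prod_le_singularSeries (le_refl (2 * (m + 1) ^ 2)))

theorem two_pow_card_primeFactors_le {n : ℕ} (hn : n ≠ 0) : 2 ^ n.primeFactors.card ≤ n :=
  calc 2 ^ n.primeFactors.card ≤ ∏ p ∈ n.primeFactors, p :=
        Finset.pow_card_le_prod _ _ _ fun _ hp => (Nat.prime_of_mem_primeFactors hp).two_le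
    _ ≤ n := Nat.le_of_dvd (Nat.pos_of_ne_zero hn) (Nat.prod_primeFactors_dvd n)

/-- Primes up to `w` are handled by the Mertens bound, and each larger one costs at most `exp (2 /
w)`. -/
theorem prod_inv_one_sub_inv_le (D : Finset ℕ) (hD : ∀ p ∈ D, p.Prime) (w : ℕ) (hw : 2 ≤ w) :
    ∏ p ∈ D, (1 - 1 / (p : ℝ))⁻¹ ≤ 2 * (8 * Real.log w) ^ 12 * Real.exp (2 * D.card / w) := by
  have hone : ∀ p ∈ Nat.primesLE w ∪ D, 1 ≤ (1 - 1 / (p : ℝ))⁻¹ := fun p hp =>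
    one_le_inv_one_sub_inv ((Finset.mem_union.1 hp).elim Nat.two_le_of_mem_primesLE
      fun hp => (hD p hp).two_le)
  have hw0 : (0 : ℝ) < w := by exact_mod_cast (by omega : 0 < w)
  calc ∏ p ∈ D, (1 - 1 / (p : ℝ))⁻¹ ≤ ∏ p ∈ Nat.primesLE w ∪ D, (1 - 1 / (p : ℝ))⁻¹ :=
        Finset.prod_le_prod_of_subset_of_one_le Finset.subset_union_right
          (fun p hp => zero_le_one.trans (hone p (Finset.mem_union_right _ hp)))
          (fun p hp _ => hone p hp)
    _ = (∏ p ∈ Nat.primesLE w, (1 - 1 / (p : ℝ))⁻¹) *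
          ∏ p ∈ D \ Nat.primesLE w, (1 - 1 / (p : ℝ))⁻¹ := by
        rw [← Finset.prod_union Finset.disjoint_sdiff, Finset.union_sdiff_self_eq_union]
    _ ≤ 2 * (8 * Real.log w) ^ 12 * Real.exp (2 * D.card / w) := by
        refine mul_le_mul (prod_primesLE_le_log_pow w hw) ?_
          (Finset.prod_nonneg fun p hp => zero_le_one.trans
            (hone p (Finset.mem_union_right _ (Finset.mem_sdiff.1 hp).1))) (by positivity)
        calc ∏ p ∈ D \ Nat.primesLE w, (1 - 1 / (p : ℝ))⁻¹
            ≤ ∏ p ∈ D \ Nat.primesLE w, Real.exp (2 / w) := by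
              refine Finset.prod_le_prod (fun p hp => zero_le_one.trans
                (hone p (Finset.mem_union_right _ (Finset.mem_sdiff.1 hp).1))) fun p hp => ?_
              rw [Finset.mem_sdiff, Nat.mem_primesLE] at hp
              have hpp := hD p hp.1
              refine (inv_one_sub_inv_le_exp hpp.two_le).trans (Real.exp_le_exp.2 ?_)
              have : w ≤ p := by
                by_contra hcon
                exact hp.2 ⟨by omega, hpp⟩
              gcongr
          _ = Real.exp ((D \ Nat.primesLE w).card * (2 / w)) := by
              rw [Finset.prod_const, ← Real.exp_nat_mul]
          _ ≤ Real.exp (2 * D.card / w) := by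
              rw [Real.exp_le_exp, mul_comm 2 (D.card : ℝ), mul_div_assoc]
              gcongr
              exact Finset.sdiff_subset

theorem IsOffsetPattern.singularSeries_le_prod_pow (hh : IsOffsetPattern h) (D : Finset ℕ)
    (hD : ∀ p ∈ D, p.Prime) (hD' : ∀ p : ℕ, p.Prime → ∀ i j, i < j → p ∣ h j - h i → p ∈ D) :
    singularSeries h ≤ (∏ p ∈ D, (1 - 1 / (p : ℝ))⁻¹) ^ m := by
  refine le_of_tendsto hh.multipliable.hasProd (Filter.Eventually.of_forall fun F => ?_)
  change ∏ p ∈ F, singularFactor h p ≤ _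
  rw [prod_singularFactor_eq]
  set G := F.image fun q : Nat.Primes => (q : ℕ) with hG
  have hGp : ∀ p ∈ G, p.Prime := fun p hp => prime_of_mem_image_coe hp
  have hone : ∀ p ∈ D, 1 ≤ (1 - 1 / (p : ℝ))⁻¹ ^ m := fun p hp =>
    one_le_pow₀ (one_le_inv_one_sub_inv (hD p hp).two_le)
  rw [← Finset.prod_pow, ← Finset.prod_inter_mul_prod_sdiff G D]
  calc (∏ p ∈ G ∩ D, eulerFactor h p) * ∏ p ∈ G \ D, eulerFactor h p
      ≤ (∏ p ∈ G ∩ D, (1 - 1 / (p : ℝ))⁻¹ ^ m) * 1 := by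
        refine mul_le_mul (Finset.prod_le_prod
          (fun p hp => eulerFactor_nonneg h (hGp p (Finset.mem_inter.1 hp).1))
          (fun p hp => eulerFactor_le_pow h (hGp p (Finset.mem_inter.1 hp).1)))
          (Finset.prod_le_one
          (fun p hp => eulerFactor_nonneg h (hGp p (Finset.mem_sdiff.1 hp).1)) fun p hp => ?_)
          (Finset.prod_nonneg
            fun p hp => eulerFactor_nonneg h (hGp p (Finset.mem_sdiff.1 hp).1))
          (Finset.prod_nonneg fun p hp => zero_le_one.trans (hone p (Finset.mem_inter.1 hp).2))
        rw [Finset.mem_sdiff] at hp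
        refine eulerFactor_le_one h (hGp p hp.1) ?_
        by_contra hr
        obtain ⟨i, j, hij, hdvd⟩ := exists_dvd_sub_of_residueCount_ne h hr hh.2
        exact hp.2 (hD' p (hGp p hp.1) i j hij hdvd)
    _ ≤ ∏ p ∈ D, (1 - 1 / (p : ℝ))⁻¹ ^ m := by
        rw [mul_one]
        exact Finset.prod_le_prod_of_subset_of_one_le Finset.inter_subset_right
          (fun p hp => zero_le_one.trans (hone p (Finset.mem_inter.1 hp).2))
          (fun p hp _ => hone p hp)

theorem IsOffsetPattern.singularSeries_le (hh : IsOffsetPattern h) {X : ℝ}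
    (hX : Real.exp 2 ≤ X) (hhX : (h (Fin.last m) : ℝ) ≤ 2 * X) :
    singularSeries h ≤ (2 * 16 ^ 12 * Real.exp (8 * (m + 1) ^ 2)) ^ m *
      Real.log (Real.log (3 * X)) ^ (12 * m) := by
  have hX0 : 0 < X := (Real.exp_pos 2).trans_le hX
  have hX2 : 2 ≤ X := by linarith [Real.add_one_le_exp (2 : ℝ)]
  set L := Real.log X with hL
  have hL2 : 2 ≤ L := (Real.le_log_iff_exp_le hX0).2 hX
  -- The cut at about `log X` matches the number of primes dividing some difference, at most `4 (m +
  -- 1) ^ 2 log X`, so the primes beyond it contribute a factor bounded in terms of `m`.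
  set w := ⌊L⌋₊ + 1 with hw
  have hwL : L ≤ w := by
    rw [hw]; push_cast; exact (Nat.lt_floor_add_one L).le
  have hwL' : (w : ℝ) ≤ 2 * L := by
    rw [hw]; push_cast; linarith [Nat.floor_le (by linarith : 0 ≤ L)]
  have hw2 : 2 ≤ w := by exact_mod_cast hL2.trans hwL
  have hl2 := Real.log_two_gt_d9
  have hlogw : Real.log w ≤ 2 * Real.log (Real.log (3 * X)) := by
    have h1 : Real.log w ≤ Real.log (2 * L) :=
      Real.log_le_log (by linarith) hwL'
    rw [Real.log_mul two_ne_zero (by linarith)] at h1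
    have h2 : Real.log 2 ≤ Real.log L := Real.log_le_log (by norm_num) hL2
    have h3 : Real.log L ≤ Real.log (Real.log (3 * X)) :=
      Real.log_le_log (by linarith) (Real.log_le_log hX0 (by linarith))
    linarith
  set D : Finset ℕ := (Finset.univ : Finset (Fin (m + 1) × Fin (m + 1))).biUnion
    fun ij => (h ij.2 - h ij.1).primeFactors with hD
  have hDp : ∀ p ∈ D, p.Prime := by
    intro p hp
    obtain ⟨ij, _, hp⟩ := Finset.mem_biUnion.1 hp
    exact Nat.prime_of_mem_primeFactors hp
  have hDdvd : ∀ p : ℕ, p.Prime → ∀ i j, i < j → p ∣ h j - h i → p ∈ D := by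
    intro p hp i j hij hdvd
    have := hh.2 hij
    exact Finset.mem_biUnion.2 ⟨(i, j), Finset.mem_univ _,
      Nat.mem_primeFactors.2 ⟨hp, hdvd, (Nat.sub_pos_of_lt this).ne'⟩⟩
  have hcard1 : ∀ n : ℕ, (n : ℝ) ≤ 2 * X → (n.primeFactors.card : ℝ) ≤ 4 * L := by
    intro n hn
    rcases Nat.eq_zero_or_pos n with rfl | hn0
    · simp; linarith
    have h1 : ((2 : ℝ) ^ n.primeFactors.card) ≤ n := by
      exact_mod_cast two_pow_card_primeFactors_le hn0.ne'
    have h2 := Real.log_le_log (by positivity) (h1.trans hn)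
    rw [Real.log_pow, Real.log_mul two_ne_zero hX0.ne'] at h2
    have h3 : Real.log 2 ≤ L := Real.log_le_log (by norm_num) hX2
    have h4 : (0 : ℝ) ≤ n.primeFactors.card := by positivity
    nlinarith
  have hcard : (D.card : ℝ) ≤ ((m : ℝ) + 1) ^ 2 * (4 * L) := by
    calc (D.card : ℝ) ≤ ∑ ij : Fin (m + 1) × Fin (m + 1),
          ((h ij.2 - h ij.1).primeFactors.card : ℝ) := by exact_mod_cast Finset.card_biUnion_le
      _ ≤ ∑ ij : Fin (m + 1) × Fin (m + 1), 4 * L := by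
          refine Finset.sum_le_sum fun ij _ => hcard1 _ (le_trans ?_ hhX)
          exact_mod_cast (Nat.sub_le _ _).trans (hh.2.monotone (Fin.le_last _))
      _ = ((m : ℝ) + 1) ^ 2 * (4 * L) := by
          rw [Finset.sum_const, nsmul_eq_mul, Finset.card_univ, Fintype.card_prod, Fintype.card_fin]
          push_cast
          ring
  have hw0 : (0 : ℝ) < w := by linarith
  refine (hh.singularSeries_le_prod_pow D hDp hDdvd).trans ?_
  rw [pow_mul, ← mul_pow]
  refine pow_le_pow_left₀ (Finset.prod_nonneg fun p hp => zero_le_one.trans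
    (one_le_inv_one_sub_inv (hDp p hp).two_le)) ?_ m
  refine (prod_inv_one_sub_inv_le D hDp w hw2).trans ?_
  have hlw : 0 ≤ Real.log w := Real.log_natCast_nonneg w
  calc 2 * (8 * Real.log w) ^ 12 * Real.exp (2 * D.card / w)
      ≤ 2 * (8 * (2 * Real.log (Real.log (3 * X)))) ^ 12 * Real.exp (8 * (m + 1) ^ 2) := by
        gcongr
        rw [div_le_iff₀ hw0]
        nlinarith [mul_le_mul_of_nonneg_left hwL (by positivity : 0 ≤ 8 * ((m : ℝ) + 1) ^ 2)]
    _ = _ := by ring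

end EulerFactor

/-! ### Primes in dyadic intervals -/

/-- Erdős's proof of Bertrand's postulate, made quantitative: the primes in `(n, 2n]` are kept as a
factor. Primes up to `√(2n)` have prime powers at most `2n`, those up to `2n / 3` occur at most
once, and those in `(2n / 3, n]` do not occur. -/
theorem centralBinom_le_mul_pow_card_primes {n : ℕ} (hn : 2 < n) :
    n.centralBinom ≤ (2 * n) ^ Nat.sqrt (2 * n) * 4 ^ (2 * n / 3) *
      (2 * n) ^ ((Finset.Ioc n (2 * n)).filter Nat.Prime).card := by
  have n2_pos : 1 ≤ 2 * n := by omega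
  set f : ℕ → ℕ := fun p => p ^ n.centralBinom.factorization p with hf
  have hfle : ∀ p, f p ≤ 2 * n := fun p => Nat.pow_factorization_choose_le (by omega)
  have hf1 : ∀ p, ¬ p.Prime → f p = 1 := fun p hp => by
    simp only [hf]
    rw [Nat.factorization_eq_zero_of_not_prime _ hp, pow_zero]
  set A := (Finset.range (2 * n / 3 + 1)).filter fun p => p.Prime ∧ p ≤ Nat.sqrt (2 * n)
  set B := (Finset.range (2 * n / 3 + 1)).filter fun p => p.Prime ∧ ¬ p ≤ Nat.sqrt (2 * n)
  set C := (Finset.Ioc n (2 * n)).filter Nat.Prime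
  have hAB : Disjoint A B := Finset.disjoint_left.2 fun p hp hq =>
    (Finset.mem_filter.1 hq).2.2 (Finset.mem_filter.1 hp).2.2
  have hC : Disjoint (A ∪ B) C := Finset.disjoint_left.2 fun p hp hq => by
    simp only [A, B, C, Finset.mem_union, Finset.mem_filter, Finset.mem_range,
      Finset.mem_Ioc] at hp hq
    omega
  have hprod : n.centralBinom = (∏ p ∈ A, f p) * (∏ p ∈ B, f p) * ∏ p ∈ C, f p := by
    rw [← Finset.prod_union hAB, ← Finset.prod_union hC]
    refine Eq.trans n.prod_pow_factorization_centralBinom.symm (Eq.symm ?_)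
    refine Finset.prod_subset (fun p hp => ?_) fun p hp hp' => ?_
    · simp only [A, B, C, Finset.mem_union, Finset.mem_filter, Finset.mem_range,
        Finset.mem_Ioc] at hp ⊢
      omega
    · by_cases hpp : p.Prime
      · simp only [A, B, C, Finset.mem_union, Finset.mem_filter, Finset.mem_range,
          Finset.mem_Ioc, hpp, true_and, and_true] at hp hp'
        have h1 : p ≤ n := by omega
        have h2 : 2 * n < 3 * p := by omega
        change p ^ _ = 1
        rw [Nat.factorization_centralBinom_of_two_mul_self_lt_three_mul hn h1 h2, pow_zero]
      · exact hf1 p hpp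
  have h1 : ∏ p ∈ A, f p ≤ (2 * n) ^ Nat.sqrt (2 * n) := by
    refine (Finset.prod_le_pow_card _ _ _ fun p _ => hfle p).trans
      (Nat.pow_le_pow_right n2_pos ?_)
    have : A ⊆ Finset.Icc 1 (Nat.sqrt (2 * n)) := fun p hp => by
      have := (Finset.mem_filter.1 hp).2
      exact Finset.mem_Icc.2 ⟨this.1.one_le, this.2⟩
    simpa using Finset.card_le_card this
  have h2 : ∏ p ∈ B, f p ≤ 4 ^ (2 * n / 3) := by
    refine le_trans ?_ (primorial_le_four_pow (2 * n / 3))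
    refine (Finset.prod_le_prod' fun p hp => (?_ : f p ≤ p)).trans ?_
    · have hp' := (Finset.mem_filter.1 hp).2
      refine (Nat.pow_le_pow_right hp'.1.pos ?_).trans (pow_one p).le
      exact Nat.factorization_choose_le_one (Nat.sqrt_lt'.mp <| not_le.1 hp'.2)
    · refine Finset.prod_le_prod_of_subset_of_one_le' (fun p hp => ?_)
        fun p hp _ => (Nat.prime_of_mem_primesLE hp).one_lt.le
      have hp' := Finset.mem_filter.1 hp
      rw [Finset.mem_range] at hp'
      exact Nat.mem_primesLE.2 ⟨by omega, hp'.2.1⟩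
  have h3 : ∏ p ∈ C, f p ≤ (2 * n) ^ C.card :=
    Finset.prod_le_pow_card _ _ _ fun p _ => hfle p
  rw [hprod]
  gcongr

theorem finite_dyadicPrimes (X : ℝ) : (dyadicPrimes X).Finite := by
  refine (Set.finite_le_nat ⌊2 * X⌋₊).subset fun p hp => ?_
  exact Nat.le_floor hp.2.2

/-- Chebyshev's lower bound for the number of primes in `[X, 2X]`. -/
theorem eventually_div_log_le_ncard_dyadicPrimes :
    ∀ᶠ X : ℝ in Filter.atTop, X / (20 * Real.log X) ≤ (dyadicPrimes X).ncard := by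
  have hlog : ∀ᶠ x : ℝ in Filter.atTop, √x * Real.log x ≤ 1 / 20 * x := by
    have h := (isLittleO_log_rpow_atTop (r := 1 / 2) (by norm_num)).bound
      (show (0 : ℝ) < 1 / 20 by norm_num)
    filter_upwards [h, Filter.eventually_ge_atTop 1] with x hx hx1
    rw [Real.norm_of_nonneg (Real.log_nonneg hx1), Real.norm_of_nonneg (by positivity),
      ← Real.sqrt_eq_rpow] at hx
    calc √x * Real.log x ≤ √x * (1 / 20 * √x) := by gcongr
      _ = 1 / 20 * (√x * √x) := by ring
      _ = 1 / 20 * x := by rw [Real.mul_self_sqrt (by linarith)]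
  have htend : Filter.Tendsto (fun X : ℝ => 2 * (⌊X⌋₊ : ℝ)) Filter.atTop Filter.atTop :=
    Filter.Tendsto.const_mul_atTop two_pos
      (tendsto_natCast_atTop_atTop.comp tendsto_nat_floor_atTop)
  filter_upwards [htend.eventually hlog, Filter.eventually_ge_atTop 4] with X hX hX4
  set n := ⌊X⌋₊ with hn
  have hn4 : 4 ≤ n := Nat.le_floor (by exact_mod_cast hX4)
  have hnX : (n : ℝ) ≤ X := Nat.floor_le (by linarith)
  have hXn : X < n + 1 := Nat.lt_floor_add_one X
  have hn4' : (4 : ℝ) ≤ n := by exact_mod_cast hn4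
  set C := (Finset.Ioc n (2 * n)).filter Nat.Prime with hC
  have hCle : C.card ≤ (dyadicPrimes X).ncard := by
    rw [← Set.ncard_coe_finset]
    refine Set.ncard_le_ncard (fun p hp => ?_) (finite_dyadicPrimes X)
    have hp := Finset.mem_filter.1 (Finset.mem_coe.1 hp)
    rw [Finset.mem_Ioc] at hp
    have h1 : ((n : ℝ) + 1) ≤ p := by exact_mod_cast hp.1.1
    have h2 : (p : ℝ) ≤ 2 * n := by exact_mod_cast hp.1.2
    exact ⟨hp.2, by linarith, by linarith⟩
  have hmain : (4 : ℝ) ^ n ≤ n * ((2 * n) ^ Nat.sqrt (2 * n) * 4 ^ (2 * n / 3) *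
      (2 * n) ^ C.card) := by
    have h := (Nat.four_pow_lt_mul_centralBinom n hn4).le.trans
      (Nat.mul_le_mul_left n (centralBinom_le_mul_pow_card_primes (by omega)))
    exact_mod_cast h
  have hn0 : (0 : ℝ) < n := by linarith
  have h := Real.log_le_log (by positivity) hmain
  rw [Real.log_mul hn0.ne' (by positivity), Real.log_mul (by positivity) (by positivity),
    Real.log_mul (by positivity) (by positivity), Real.log_pow, Real.log_pow, Real.log_pow,
    Real.log_pow] at h
  have hL0 : 0 ≤ Real.log (2 * n) := Real.log_nonneg (by linarith)
  have hs : (Nat.sqrt (2 * n) : ℝ) ≤ √(2 * n) := by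
    have := Real.nat_sqrt_le_real_sqrt (a := 2 * n)
    push_cast at this
    exact this
  have hs1 : 1 ≤ √(2 * (n : ℝ)) := Real.one_le_sqrt.2 (by linarith)
  have hd : ((2 * n / 3 : ℕ) : ℝ) ≤ 2 * n / 3 := by
    have := Nat.cast_div_le (α := ℝ) (m := 2 * n) (n := 3)
    push_cast at this
    exact this
  have hl4 : Real.log 4 = 2 * Real.log 2 := by
    rw [show (4 : ℝ) = 2 ^ 2 by norm_num, Real.log_pow]; norm_num
  have hl2 := Real.log_two_gt_d9
  have hlog1 : Real.log n ≤ √(2 * n) * Real.log (2 * n) :=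
    (Real.log_le_log hn0 (by linarith)).trans (le_mul_of_one_le_left hL0 hs1)
  have hlog2 : (Nat.sqrt (2 * n) : ℝ) * Real.log (2 * n) ≤ √(2 * n) * Real.log (2 * n) := by
    gcongr
  have hlog3 : ((2 * n / 3 : ℕ) : ℝ) * Real.log 4 ≤ 2 * n / 3 * Real.log 4 := by
    have : 0 ≤ Real.log 4 := Real.log_nonneg (by norm_num)
    gcongr
  -- The gain `(n / 3) log 4 > 0.46 n` exceeds the two terms `√(2n) log (2n) ≤ n / 10` by more than
  -- `n / 4`, while `X < n + 1 ≤ 5n / 4`.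
  have hfin : X / 10 ≤ C.card * Real.log (2 * n) := by
    rw [hl4] at h hlog3
    nlinarith
  have hlX : 0 < Real.log X := Real.log_pos (by linarith)
  have hlog4 : Real.log (2 * n) ≤ 2 * Real.log X := by
    have : 2 * Real.log X = Real.log (X ^ 2) := by rw [Real.log_pow]; norm_num
    rw [this]
    exact Real.log_le_log (by linarith) (by nlinarith)
  have hCle' : (C.card : ℝ) ≤ (dyadicPrimes X).ncard := by exact_mod_cast hCle
  have hc0 : (0 : ℝ) ≤ C.card := by positivity
  refine le_trans ?_ hCle'
  rw [div_le_iff₀ (by positivity)]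
  nlinarith

theorem primeLaw_real_apply (X : ℝ) (S : Set ℕ) :
    (primeLaw X).real S =
      ((dyadicPrimes X ∩ S).ncard : ℝ) / ((dyadicPrimes X).ncard : ℝ) := by
  have hcount : ∀ T : Set ℕ, T.Finite → (Measure.count T).toReal = (T.ncard : ℝ) := by
    intro T hT
    rw [Measure.count_apply (MeasurableSet.of_discrete), ← hT.cast_ncard_eq]
    simp
  have hfin := finite_dyadicPrimes X
  rw [primeLaw, uniformOn, measureReal_def, cond_apply MeasurableSet.of_discrete,
    ENNReal.toReal_mul, ENNReal.toReal_inv, hcount _ hfin, hcount _ (hfin.inter_of_left S),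
    div_eq_inv_mul]

/-! ### Sieving for constellations -/

section

variable {m : ℕ} {h : Fin (m + 1) → ℕ}

theorem exists_dvd_add_of_residueCount_eq {p : ℕ} (hp : p.Prime) (hr : residueCount h p = p)
    (n : ℕ) : ∃ j, p ∣ n + h j := by
  have : NeZero p := ⟨hp.ne_zero⟩
  have huniv : (Finset.univ.image fun j => ((h j : ℕ) : ZMod p)) = Finset.univ :=
    Finset.eq_univ_of_card _ (by rw [ZMod.card]; exact hr)
  have hmem : (-(n : ZMod p)) ∈ Finset.univ.image fun j => ((h j : ℕ) : ZMod p) := by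
    rw [huniv]; exact Finset.mem_univ _
  obtain ⟨j, _, hj⟩ := Finset.mem_image.1 hmem
  refine ⟨j, ?_⟩
  rw [← ZMod.natCast_eq_zero_iff, Nat.cast_add, hj, add_neg_cancel]

theorem not_constellation_of_residueCount_eq {p : ℕ} (hp : p.Prime) (hr : residueCount h p = p)
    {n : ℕ} (hn : m + 1 < n) : ¬ Constellation h n := by
  intro hc
  obtain ⟨j, hj⟩ := exists_dvd_add_of_residueCount_eq hp hr n
  have h1 := (Nat.prime_dvd_prime_iff_eq hp (hc j)).1 hj
  have h2 := residueCount_le h p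
  omega

/-- Beyond `2 (m + 1) ^ 2` the factors cost at most one half; below it each is at least `1 / p`, and
the primorial is at most a power of 4. The uniformity in `h` lets the sieve error be absorbed into
the main term. -/
theorem IsOffsetPattern.le_singularSeries (hh : IsOffsetPattern h)
    (hr : ∀ p : ℕ, p.Prime → residueCount h p < p) :
    1 / 2 * ((4 : ℝ) ^ (2 * (m + 1) ^ 2))⁻¹ ≤ singularSeries h := by
  refine le_trans ?_ (hh.half_prod_le_singularSeries (le_refl (2 * (m + 1) ^ 2)))
  gcongr
  have h1 : ((∏ p ∈ Nat.primesLE (2 * (m + 1) ^ 2), p : ℕ) : ℝ) ≤ 4 ^ (2 * (m + 1) ^ 2) := by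
    exact_mod_cast primorial_le_four_pow (2 * (m + 1) ^ 2)
  have h0 : (0 : ℝ) < ((∏ p ∈ Nat.primesLE (2 * (m + 1) ^ 2), p : ℕ) : ℝ) := by
    exact_mod_cast Finset.prod_pos fun p hp => (Nat.prime_of_mem_primesLE hp).pos
  refine (inv_anti₀ h0 h1).trans ?_
  rw [Nat.cast_prod, ← Finset.prod_inv_distrib]
  refine Finset.prod_le_prod (fun p _ => by positivity) fun p hp => ?_
  have hpp := Nat.prime_of_mem_primesLE hp
  have hp0 : (0 : ℝ) < p := by exact_mod_cast hpp.pos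
  have hx0 := one_sub_inv_pos hpp.two_le
  have hx1 : 1 - 1 / (p : ℝ) ≤ 1 := by
    have : 0 ≤ 1 / (p : ℝ) := by positivity
    linarith
  have h2 : ((residueCount h p : ℝ) + 1) ≤ p := by exact_mod_cast hr p hpp
  have h3 : (p : ℝ)⁻¹ ≤ 1 - (residueCount h p : ℝ) / p := by
    rw [← sub_nonneg]
    have : 1 - (residueCount h p : ℝ) / p - (p : ℝ)⁻¹ = (p - (residueCount h p + 1)) / p := by
      field_simp
      ring
    rw [this]
    exact div_nonneg (by linarith) hp0.le
  unfold eulerFactor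
  rw [le_div_iff₀ (pow_pos hx0 _)]
  calc (p : ℝ)⁻¹ * (1 - 1 / (p : ℝ)) ^ (m + 1) ≤ (p : ℝ)⁻¹ * 1 := by
        gcongr
        exact pow_le_one₀ hx0.le hx1
    _ ≤ _ := by rw [mul_one]; exact h3

theorem prod_one_sub_residueCount_le (hh : IsOffsetPattern h) {z : ℕ} (hz2 : 2 ≤ z)
    (hz : 2 * (m + 1) ^ 2 ≤ z) :
    ∏ p ∈ Nat.primesLE z, (1 - (residueCount h p : ℝ) / p) ≤
      2 * singularSeries h / Real.log z ^ (m + 1) := by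
  have hlog : 0 < Real.log z := Real.log_pos (by exact_mod_cast hz2)
  have h1 := hh.half_prod_le_singularSeries hz
  have h2 := log_le_prod_primesLE z
  set Q := ∏ p ∈ Nat.primesLE z, (1 - 1 / (p : ℝ))⁻¹ with hQ
  have hQ0 : 0 < Q := hlog.trans_le h2
  have e : ∏ p ∈ Nat.primesLE z, eulerFactor h p =
      (∏ p ∈ Nat.primesLE z, (1 - (residueCount h p : ℝ) / p)) * Q ^ (m + 1) := by
    rw [hQ, ← Finset.prod_pow, ← Finset.prod_mul_distrib]
    refine Finset.prod_congr rfl fun p _ => ?_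
    rw [eulerFactor, inv_pow, div_eq_mul_inv]
  rw [e] at h1
  calc ∏ p ∈ Nat.primesLE z, (1 - (residueCount h p : ℝ) / p)
      ≤ 2 * singularSeries h / Q ^ (m + 1) := by
        rw [le_div_iff₀ (by positivity)]
        linarith
    _ ≤ 2 * singularSeries h / Real.log z ^ (m + 1) := by
        have := hh.singularSeries_nonneg
        gcongr

/-- The Selberg upper bound for the number of `n` in an interval for which no `n + h j` has a
prime factor up to `z`. -/
theorem IsOffsetPattern.card_sifted_le (hh : IsOffsetPattern h)
    (hr : ∀ p : ℕ, p.Prime → residueCount h p < p) {z : ℕ} (hz2 : 2 ≤ z)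
    (hz : 2 * (m + 1) ^ 2 ≤ z) (a N : ℕ) :
    (((Finset.Ico a (a + N)).filter fun n : ℕ =>
      ∀ p ∈ Nat.primesLE z, ∀ j, ¬ p ∣ n + h j).card : ℝ) ≤
      4 * N * (singularSeries h / Real.log z ^ (m + 1)) + (z : ℝ) ^ (6 * (6 * (m + 1) + 1)) := by
  classical
  set B : ∀ p : ℕ, Finset (ZMod p) := fun p =>
    (Finset.univ.image fun j => ((h j : ℕ) : ZMod p)).image (fun x => -x) with hB
  have hBcard : ∀ p, (B p).card = residueCount h p := fun p =>
    Finset.card_image_of_injective _ neg_injective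
  have hprime : ∀ p ∈ Nat.primesLE z, p.Prime := fun p hp => Nat.prime_of_mem_primesLE hp
  -- The level `z ^ (6 (m + 1) + 1)` is the truncation in Rankin's bound with `k = m + 1`.
  have hsieve := selberg_sieve (Nat.primesLE z) hprime B
    (fun p _ => Finset.card_pos.1 (by rw [hBcard]; exact one_le_residueCount h p))
    (fun p hp => by rw [hBcard]; exact hr p (hprime p hp)) (z ^ (6 * (m + 1) + 1))
    (Nat.one_le_pow _ _ (by omega)) a N
  simp only [hBcard] at hsieve
  have hfilter : (Finset.Ico a (a + N)).filter (fun n : ℕ =>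
      ∀ p ∈ Nat.primesLE z, ∀ j, ¬ p ∣ n + h j) ⊆
      (Finset.Ico a (a + N)).filter fun n : ℕ => ∀ p ∈ Nat.primesLE z, (n : ZMod p) ∉ B p := by
    refine Finset.monotone_filter_right _ fun n _ hn p hp hmem => ?_
    obtain ⟨x, hx, hxn⟩ := Finset.mem_image.1 hmem
    obtain ⟨j, _, rfl⟩ := Finset.mem_image.1 hx
    refine hn p hp j ?_
    rw [← ZMod.natCast_eq_zero_iff, Nat.cast_add, ← hxn, neg_add_cancel]
  have hcard : (((Finset.Ico a (a + N)).filter fun n : ℕ =>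
      ∀ p ∈ Nat.primesLE z, ∀ j, ¬ p ∣ n + h j).card : ℝ) ≤
      ((Finset.Ico a (a + N)).filter fun n : ℕ =>
        ∀ p ∈ Nat.primesLE z, (n : ZMod p) ∉ B p).card := by
    exact_mod_cast Finset.card_le_card hfilter
  have hp0 : ∀ p ∈ Nat.primesLE z, (0 : ℝ) < p := fun p hp => by
    exact_mod_cast (hprime p hp).pos
  have hlt : ∀ p ∈ Nat.primesLE z, (residueCount h p : ℝ) / p < 1 := fun p hp => by
    rw [div_lt_one (hp0 p hp)]
    exact_mod_cast hr p (hprime p hp)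
  have hrankin := half_prod_le_selberg_sum (m + 1) z hz2 (fun p => (residueCount h p : ℝ) / p)
    (fun p hp => div_pos (by exact_mod_cast one_le_residueCount h p) (hp0 p hp)) hlt
    (fun p hp => by
      have : (residueCount h p : ℝ) ≤ ((m + 1 : ℕ) : ℝ) := by
        exact_mod_cast residueCount_le h p
      exact div_le_div_of_nonneg_right this (hp0 p hp).le)
  set V := ∏ p ∈ Nat.primesLE z, (1 - (residueCount h p : ℝ) / p) with hV
  have hV0 : 0 < V := Finset.prod_pos fun p hp => sub_pos.2 (hlt p hp)
  rw [Finset.prod_inv_distrib, ← hV] at hrankin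
  have hinv := inv_anti₀ (by positivity) hrankin
  rw [mul_inv, inv_inv] at hinv
  have hVS := prod_one_sub_residueCount_le hh hz2 hz
  have hN : (0 : ℝ) ≤ N := by positivity
  refine hcard.trans (hsieve.trans (add_le_add ?_ (le_of_eq ?_)))
  · calc _ ≤ (N : ℝ) * ((1 / 2)⁻¹ * V) := mul_le_mul_of_nonneg_left hinv hN
      _ ≤ N * ((1 / 2)⁻¹ * (2 * singularSeries h / Real.log z ^ (m + 1))) := by gcongr
      _ = _ := by ring
  · push_cast
    rw [← pow_mul, mul_comm _ 6]

theorem IsOffsetPattern.ncard_constellation_le (hh : IsOffsetPattern h)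
    (hr : ∀ p : ℕ, p.Prime → residueCount h p < p) {z : ℕ} (hz2 : 2 ≤ z)
    (hz : 2 * (m + 1) ^ 2 ≤ z) {X : ℝ}
    (hzX : (z : ℝ) ^ (6 * (6 * (m + 1) + 1) + (m + 1)) ≤ X) :
    ((dyadicPrimes X ∩ {n | Constellation h n}).ncard : ℝ) ≤
      (8 + 2 * 4 ^ (2 * (m + 1) ^ 2)) * X * (singularSeries h / Real.log z ^ (m + 1)) := by
  set s := 6 * (6 * (m + 1) + 1) with hs
  have hz2' : (2 : ℝ) ≤ z := by exact_mod_cast hz2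
  have hlog : 0 < Real.log z := Real.log_pos (by linarith)
  have hzltX : (z : ℝ) < X := by
    refine lt_of_lt_of_le ?_ hzX
    exact lt_self_pow₀ (by linarith) (by omega)
  have hX0 : 0 < X := by linarith
  set a := ⌈X⌉₊ with ha
  set N := ⌊2 * X⌋₊ + 1 - a with hN
  have hNX : (N : ℝ) ≤ 2 * X := by
    have h1 : a ≤ ⌊2 * X⌋₊ + 1 := by
      have : (a : ℝ) < X + 1 := Nat.ceil_lt_add_one hX0.le
      have h2 : 2 * X < ⌊2 * X⌋₊ + 1 := Nat.lt_floor_add_one _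
      have : (a : ℝ) < ((⌊2 * X⌋₊ + 1 + 1 : ℕ) : ℝ) := by push_cast; linarith
      have := Nat.cast_lt.1 this
      omega
    have h2 : (N : ℝ) = ⌊2 * X⌋₊ + 1 - a := by
      rw [hN, Nat.cast_sub h1]; push_cast; ring
    have h3 : X ≤ a := Nat.le_ceil X
    have h4 : (⌊2 * X⌋₊ : ℝ) ≤ 2 * X := Nat.floor_le (by linarith)
    linarith
  have hsub : dyadicPrimes X ∩ {n | Constellation h n} ⊆
      ((Finset.Ico a (a + N)).filter fun n : ℕ =>
        ∀ p ∈ Nat.primesLE z, ∀ j, ¬ p ∣ n + h j : Finset ℕ) := by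
    rintro n ⟨⟨_, hn1, hn2⟩, hn3⟩
    have h1 : a ≤ n := Nat.ceil_le.2 hn1
    have h2 : n ≤ ⌊2 * X⌋₊ := Nat.le_floor hn2
    refine Finset.mem_coe.2 (Finset.mem_filter.2 ⟨Finset.mem_Ico.2 ⟨h1, by omega⟩, ?_⟩)
    intro p hp j hdvd
    rw [Nat.mem_primesLE] at hp
    have h3 := (Nat.prime_dvd_prime_iff_eq hp.2 (hn3 j)).1 hdvd
    have h4 : z < n := by exact_mod_cast hzltX.trans_le hn1
    omega
  have hcard : ((dyadicPrimes X ∩ {n | Constellation h n}).ncard : ℝ) ≤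
      ((Finset.Ico a (a + N)).filter fun n : ℕ =>
        ∀ p ∈ Nat.primesLE z, ∀ j, ¬ p ∣ n + h j).card := by
    rw [← Set.ncard_coe_finset]
    exact_mod_cast Set.ncard_le_ncard hsub (Finset.finite_toSet _)
  have hS := hh.le_singularSeries hr
  have hS0 := hh.singularSeries_nonneg
  -- The spare exponent `m + 1` in `hzX` pays for `(log z) ^ (m + 1)`, and the lower bound on the
  -- singular series supplies the missing factor.
  have herr : (z : ℝ) ^ s ≤
      2 * 4 ^ (2 * (m + 1) ^ 2) * X * (singularSeries h / Real.log z ^ (m + 1)) := by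
    have h1 : (z : ℝ) ^ s * Real.log z ^ (m + 1) ≤ X := by
      refine le_trans ?_ hzX
      rw [pow_add (z : ℝ) s (m + 1)]
      exact mul_le_mul_of_nonneg_left
        (pow_le_pow_left₀ hlog.le (Real.log_le_self (by linarith)) _) (by positivity)
    have h2 : 1 ≤ 2 * 4 ^ (2 * (m + 1) ^ 2) * singularSeries h := by
      calc (1 : ℝ) = 2 * 4 ^ (2 * (m + 1) ^ 2) * (1 / 2 * ((4 : ℝ) ^ (2 * (m + 1) ^ 2))⁻¹) := by
            field_simp
        _ ≤ _ := by gcongr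
    calc (z : ℝ) ^ s ≤ X / Real.log z ^ (m + 1) := by rwa [le_div_iff₀ (by positivity)]
      _ ≤ X / Real.log z ^ (m + 1) * (2 * 4 ^ (2 * (m + 1) ^ 2) * singularSeries h) :=
          le_mul_of_one_le_right (by positivity) h2
      _ = _ := by ring
  have hq : 0 ≤ singularSeries h / Real.log z ^ (m + 1) := by positivity
  calc _ ≤ _ := hcard
    _ ≤ _ := hh.card_sifted_le hr hz2 hz a N
    _ ≤ 4 * (2 * X) * (singularSeries h / Real.log z ^ (m + 1)) +
        2 * 4 ^ (2 * (m + 1) ^ 2) * X * (singularSeries h / Real.log z ^ (m + 1)) := by gcongr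
    _ = _ := by ring

end

/-! ### Choice of the sieve level and conclusion -/

/-- The witness is the integer part of `X ^ (1 / r)`. Rounding down costs at most a factor 2, and
its contribution `r log 2` is at most half of `log X` for large `X`. -/
theorem eventually_exists_sieve_level (r w : ℕ) (hr : r ≠ 0) :
    ∀ᶠ X : ℝ in Filter.atTop, ∃ z : ℕ, w ≤ z ∧ (z : ℝ) ^ r ≤ X ∧
      Real.log X ≤ 2 * r * Real.log z := by
  have hr0 : (0 : ℝ) < r := by exact_mod_cast Nat.pos_of_ne_zero hr
  filter_upwards [(tendsto_rpow_atTop (one_div_pos.2 hr0)).eventually_ge_atTop ((w : ℝ) + 1),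
    Real.tendsto_log_atTop.eventually_ge_atTop (2 * r * Real.log 2),
    Filter.eventually_gt_atTop 0] with X hX hlog hX0
  set t := X ^ (1 / (r : ℝ)) with ht
  have hw0 : (0 : ℝ) ≤ w := by positivity
  have ht1 : 1 ≤ t := by linarith
  refine ⟨⌊t⌋₊, Nat.le_floor (by linarith), ?_, ?_⟩
  · calc ((⌊t⌋₊ : ℕ) : ℝ) ^ r ≤ t ^ r := by
          gcongr
          exact Nat.floor_le (by linarith)
      _ = X := by
          rw [ht, ← Real.rpow_natCast, ← Real.rpow_mul hX0.le, one_div, inv_mul_cancel₀ hr0.ne',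
            Real.rpow_one]
  · have h1 : (1 : ℝ) ≤ ⌊t⌋₊ := by exact_mod_cast Nat.le_floor (by exact_mod_cast ht1)
    have h2 : t ≤ 2 * ⌊t⌋₊ := by linarith [Nat.lt_floor_add_one t]
    have h3 := Real.log_le_log (by linarith) h2
    rw [Real.log_mul two_ne_zero (by linarith), show Real.log t = _ from Real.log_rpow hX0 _,
      one_div, inv_mul_le_iff₀ hr0] at h3
    nlinarith

/-- The uniform sieve upper bound for the probability of a constellation. -/
theorem exists_primeLaw_constellation_le (m : ℕ) : ∃ C : ℝ, 0 < C ∧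
    ∀ᶠ X : ℝ in Filter.atTop, ∀ h : Fin (m + 1) → ℕ, IsOffsetPattern h →
      (primeLaw X).real {p | Constellation h p} ≤
        C * (singularSeries h / Real.log X ^ m) := by
  set r := 6 * (6 * (m + 1) + 1) + (m + 1) with hr
  set K : ℝ := 8 + 2 * 4 ^ (2 * (m + 1) ^ 2) with hK
  have hK0 : 0 < K := by positivity
  have hr0 : (0 : ℝ) < r := by positivity
  refine ⟨20 * K * (2 * r) ^ (m + 1), by positivity, ?_⟩
  filter_upwards [eventually_exists_sieve_level r (max 2 (2 * (m + 1) ^ 2)) (by omega),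
    eventually_div_log_le_ncard_dyadicPrimes, Filter.eventually_gt_atTop ((m : ℝ) + 1),
    Filter.eventually_ge_atTop 3] with X hz hcount hXm hX3 h hh
  have hlogX : 0 < Real.log X := Real.log_pos (by linarith)
  have hS0 := hh.singularSeries_nonneg
  rw [primeLaw_real_apply]
  by_cases hres : ∀ p : ℕ, p.Prime → residueCount h p < p
  · obtain ⟨z, hwz, hzX, hzlog⟩ := hz
    have hz2 := (le_max_left _ _).trans hwz
    have hlogz : 0 < Real.log z := Real.log_pos (by exact_mod_cast hz2)
    have hmain := hh.ncard_constellation_le hres hz2 ((le_max_right _ _).trans hwz) hzX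
    have hzlog' : Real.log X ^ (m + 1) ≤ (2 * r) ^ (m + 1) * Real.log z ^ (m + 1) := by
      rw [← mul_pow]
      gcongr
    have hbound : singularSeries h / Real.log z ^ (m + 1) ≤
        singularSeries h * (2 * r) ^ (m + 1) / Real.log X ^ (m + 1) := by
      rw [div_le_div_iff₀ (by positivity) (by positivity), mul_assoc]
      gcongr
    have hden : 0 < X / (20 * Real.log X) := by positivity
    -- Conditioning on `n` being prime divides by `X / (20 log X)`, lowering the power of the
    -- logarithm from `m + 1` to `m`.
    calc _ ≤ K * X * (singularSeries h / Real.log z ^ (m + 1)) / (X / (20 * Real.log X)) := by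
          gcongr
      _ ≤ K * X * (singularSeries h * (2 * r) ^ (m + 1) / Real.log X ^ (m + 1)) /
            (X / (20 * Real.log X)) := by gcongr
      _ = _ := by
          rw [pow_succ (Real.log X)]
          field_simp
  · push Not at hres
    obtain ⟨p, hp, hpr⟩ := hres
    have heq := le_antisymm (residueCount_le_self h hp) hpr
    have hempty : dyadicPrimes X ∩ {n | Constellation h n} = ∅ := by
      refine Set.eq_empty_of_forall_notMem fun n hn => ?_
      refine not_constellation_of_residueCount_eq hp heq ?_ hn.2
      exact_mod_cast hXm.trans_le hn.1.2.1
    rw [hempty, Set.ncard_empty, Nat.cast_zero, zero_div]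
    positivity

theorem mainTheorem5 (m : ℕ) (hm : 1 ≤ m) :
    -- the Euler product defining the singular series converges
    (∀ h : Fin (m + 1) → ℕ, IsOffsetPattern h → Multipliable (singularFactor h)) ∧
    -- all constants depend on `m` only
    ∃ (C C' X₀ : ℝ) (A : ℕ), 0 < C ∧ 0 < C' ∧ 3 ≤ X₀ ∧
      -- one pattern, uniformly in the pattern
      (∀ X : ℝ, X₀ ≤ X → ∀ h : Fin (m + 1) → ℕ, IsOffsetPattern h →
        (h (Fin.last m) : ℝ) ≤ 2 * X →
          (primeLaw X).real {p | Constellation h p}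
              ≤ C * (singularSeries h / Real.log X ^ m) ∧
          singularSeries h / Real.log X ^ m
              ≤ C' * (Real.log (Real.log (3 * X)) ^ A / Real.log X ^ m)) ∧
      -- finite families, uniformly in the family, with offsets at most `2X`
      (∀ X : ℝ, X₀ ≤ X → ∀ H : Finset (Fin (m + 1) → ℕ),
        (∀ h ∈ H, IsOffsetPattern h ∧ (h (Fin.last m) : ℝ) ≤ 2 * X) →
          (primeLaw X).real {p | ∃ h ∈ H, Constellation h p}
              ≤ C' * ((H.card : ℝ) * Real.log (Real.log (3 * X)) ^ A / Real.log X ^ m)) ∧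
      -- an arbitrary fixed finite family, for `X` large in terms of the family
      (∀ H : Finset (Fin (m + 1) → ℕ), (∀ h ∈ H, IsOffsetPattern h) →
        ∃ X₁ : ℝ, ∀ X : ℝ, X₁ ≤ X →
          (primeLaw X).real {p | ∃ h ∈ H, Constellation h p}
              ≤ C' * ((H.card : ℝ) * Real.log (Real.log (3 * X)) ^ A / Real.log X ^ m)) := by
  refine ⟨fun h hh => hh.multipliable, ?_⟩
  obtain ⟨C, hC, hev⟩ := exists_primeLaw_constellation_le m
  obtain ⟨X₂, hX₂⟩ := Filter.eventually_atTop.1 hev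
  set D : ℝ := (2 * 16 ^ 12 * Real.exp (8 * (m + 1) ^ 2)) ^ m with hD
  have hD0 : 0 < D := by positivity
  set X₀ : ℝ := max 3 (max X₂ (Real.exp 2)) with hX₀
  have h3 : 3 ≤ X₀ := le_max_left _ _
  have h2 : X₂ ≤ X₀ := (le_max_left _ _).trans (le_max_right _ _)
  have he : Real.exp 2 ≤ X₀ := (le_max_right _ _).trans (le_max_right _ _)
  have hll : ∀ X : ℝ, X₀ ≤ X → 0 ≤ Real.log (Real.log (3 * X)) := fun X hX => by
    have : (1 : ℝ) ≤ Real.log (3 * X) :=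
      (Real.le_log_iff_exp_le (by linarith)).2 (by linarith [Real.exp_one_lt_d9])
    exact Real.log_nonneg this
  have hL : ∀ X : ℝ, X₀ ≤ X → 0 < Real.log X := fun X hX => Real.log_pos (by linarith)
  have hsing : ∀ X : ℝ, X₀ ≤ X → ∀ h : Fin (m + 1) → ℕ, IsOffsetPattern h →
      (h (Fin.last m) : ℝ) ≤ 2 * X → singularSeries h / Real.log X ^ m ≤
        D * (Real.log (Real.log (3 * X)) ^ (12 * m) / Real.log X ^ m) := fun X hX h hh hhX => by
    have := hL X hX
    rw [← mul_div_assoc]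
    gcongr
    exact hh.singularSeries_le (he.trans hX) hhX
  have hfam : ∀ X : ℝ, X₀ ≤ X → ∀ H : Finset (Fin (m + 1) → ℕ),
      (∀ h ∈ H, IsOffsetPattern h ∧ (h (Fin.last m) : ℝ) ≤ 2 * X) →
        (primeLaw X).real {p | ∃ h ∈ H, Constellation h p} ≤
          (C + 1) * D * ((H.card : ℝ) * Real.log (Real.log (3 * X)) ^ (12 * m) /
            Real.log X ^ m) := fun X hX H hH => by
    have hLX := hL X hX
    have hllX := hll X hX
    have hset : {p | ∃ h ∈ H, Constellation h p} = ⋃ h ∈ H, {p | Constellation h p} := by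
      ext p; simp
    rw [hset]
    calc _ ≤ ∑ h ∈ H, (primeLaw X).real {p | Constellation h p} :=
          measureReal_biUnion_finset_le _ _
      _ ≤ ∑ h ∈ H, (C + 1) * (D * (Real.log (Real.log (3 * X)) ^ (12 * m) /
            Real.log X ^ m)) := by
          refine Finset.sum_le_sum fun h hh => ?_
          refine (hX₂ X (h2.trans hX) h (hH h hh).1).trans ?_
          have := (hH h hh).1.singularSeries_nonneg
          gcongr
          · linarith
          · exact hsing X hX h (hH h hh).1 (hH h hh).2
      _ = _ := by
          rw [Finset.sum_const, nsmul_eq_mul]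
          ring
  -- The factor `C + 1` lets one constant dominate both `D`, for the singular series, and `C * D`,
  -- for the union bound.
  refine ⟨C, (C + 1) * D, X₀, 12 * m, hC, by positivity, h3, fun X hX h hh hhX => ⟨?_, ?_⟩,
    hfam, fun H hH => ?_⟩
  · exact hX₂ X (h2.trans hX) h hh
  · refine (hsing X hX h hh hhX).trans ?_
    have := hL X hX
    have := hll X hX
    gcongr
    exact le_mul_of_one_le_left hD0.le (by linarith)
  -- Past the largest offset occurring in `H`, the uniform family bound applies.
  · refine ⟨max X₀ (H.sup fun h => h (Fin.last m) : ℕ), fun X hX => ?_⟩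
    have hX0 := (le_max_left _ _).trans hX
    refine hfam X hX0 H fun h hh => ⟨hH h hh, ?_⟩
    have h4 : (h (Fin.last m) : ℝ) ≤ ((H.sup fun h => h (Fin.last m) : ℕ) : ℝ) := by
      exact_mod_cast Finset.le_sup (f := fun h : Fin (m + 1) → ℕ => h (Fin.last m)) hh
    have h5 := (le_max_right _ _).trans hX
    linarith
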